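/- Let $Q=[0,1]^{\mathbb N}$ be the Hilbert cube with the product topology, let $n\ge 0$ be an integer, and let $H_n^s$ denote the $n$-dimensional (unreduced) singular homology functor with integer coefficients. Let $f\colon Q\to Q$ be a hereditary equivalence with respect to $H_n^s$; that is, $f$ is a bijection (not assumed continuous), and there exist isomorphisms of abelian groups $f_*(M)\colon H_n^s(M)\to H_n^s(f(M))$, one for every subspace $M\subset Q$, such that for all subsets $N\subset M\subset Q$ $$f_*(M)\circ (i_{N,M})_* = (i_{f(N),f(M)})_*\circ f_*(N),$$ where $i_{N,M}\colon N\to M$ and $i_{f(N),f(M)}\colon f(N)\to f(M)$ are the inclusions and $(\cdot)_*$ denotes the homomorphisms they induce on $H_n^s$. Then $f$ is a homeomorphism. -/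

import Mathlib

open CategoryTheory

/-- The Hilbert cube `[0,1]^ℕ`, with the product topology. -/
abbrev HilbertCube : Type := ℕ → unitInterval

/-- Singular homology in degree `n` with integer coefficients. -/
noncomputable abbrev singularHomologyZ (n : ℕ) : TopCat.{0} ⥤ AddCommGrpCat.{0} :=
  (AlgebraicTopology.singularHomologyFunctor AddCommGrpCat.{0} n).obj (AddCommGrpCat.of ℤ)

/-- The inclusion `N ⊆ M` of subspaces of `X`, as a continuous map. -/
def subspaceIncl {X : Type} [TopologicalSpace X] {N M : Set X} (h : N ⊆ M) :
    TopCat.of N ⟶ TopCat.of M :=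
  TopCat.ofHom ⟨Set.inclusion h, continuous_inclusion h⟩

/-- `f : X → Y` is a hereditary equivalence with respect to the covariant functor `F`: it is a
bijection (not assumed continuous), and there are isomorphisms `F(M) ≅ F(f(M))` for all subspaces
`M` of `X` that commute with the maps generated by the inclusions `N ⊆ M`. -/
structure IsHereditaryEquivalence (F : TopCat.{0} ⥤ AddCommGrpCat.{0})
    {X Y : Type} [TopologicalSpace X] [TopologicalSpace Y] (f : X → Y) : Prop where
  bijective : Function.Bijective f
  exists_iso : ∃ φ : ∀ M : Set X, F.obj (TopCat.of M) ≅ F.obj (TopCat.of (f '' M)),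
    ∀ (N M : Set X) (h : N ⊆ M),
      F.map (subspaceIncl h) ≫ (φ M).hom =
        (φ N).hom ≫ F.map (subspaceIncl (Set.image_mono h : f '' N ⊆ f '' M))

/-! Homology detects the interior of an embedded (n+1)-cube. The fundamental class of its boundary
dies in the cube, but survives in every set between boundary and cube that misses an interior point,
because radial projection from that point leads back to the boundary (`exists_homology_class`,
`mem_of_map_toBdryImage_eq_zero`). Singular chains have compact carriers, so after transport by `f`
the class already dies in the image of the boundary together with some compact `K` inside the image
of the cube. Pulled back, this set must contain the whole interior, so `K` contains the image of the
interior (`IsHereditaryEquivalence.exists_isCompact`).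

If `f` were discontinuous at `x`, some sequence `u k → x` would have `f (u k) → f z` with `z ≠ x`.
Thread an embedded cube through almost all the `u k`, in its interior, while avoiding `z`
(`exists_section`, `exists_cube_of_section`). Then `f z` lies in the closed set `K`, hence `z` lies
in the cube: a contradiction. The cube is built over the first coordinate, so this only treats
sequences whose first coordinate differs from that of `x`; density of such points and regularity
remove the restriction. A continuous bijection of compact Hausdorff spaces is a homeomorphism.

The boundary class is shown to be nonzero by a Sperner-type degree: label points, count fully
labelled simplices of a fine subdivision with signs, and show that the count kills boundaries but
equals 1 on the fundamental cycle. -/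

/-! ### Affine chains -/

/-- Chains of ordered tuples of `n` points of `V`, augmented by the empty tuple. -/
abbrev AffineChain (V : Type*) (n : ℕ) : Type _ := (Fin n → V) →₀ ℤ

namespace AffineChain

variable {V W : Type*}

/-- The tuple `v` as a chain. -/
noncomputable abbrev of {n : ℕ} (v : Fin n → V) : AffineChain V n := Finsupp.single v 1

/-- The linear map with prescribed values on tuples. -/
noncomputable abbrev lift {n : ℕ} {M : Type*} [AddCommGroup M] (g : (Fin n → V) → M) :
    AffineChain V n →ₗ[ℤ] M := Finsupp.linearCombination ℤ g

theorem lift_of {n : ℕ} {M : Type*} [AddCommGroup M] (g : (Fin n → V) → M) (v : Fin n → V) :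
    lift g (of v) = g v := by simp

theorem hom_ext {n : ℕ} {M : Type*} [AddCommGroup M] {f g : AffineChain V n →ₗ[ℤ] M}
    (h : ∀ v, f (of v) = g (of v)) : f = g :=
  Finsupp.lhom_ext' fun v => LinearMap.ext_ring (h v)

/-- The boundary of a chain. -/
noncomputable def bd (n : ℕ) : AffineChain V (n + 1) →ₗ[ℤ] AffineChain V n :=
  lift fun v => ∑ i : Fin (n + 1), (-1 : ℤ) ^ (i : ℕ) • of (v ∘ i.succAbove)

/-- The cone with apex `b`. -/
noncomputable def cone (b : V) (n : ℕ) : AffineChain V n →ₗ[ℤ] AffineChain V (n + 1) :=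
  lift fun v => of (Fin.cons b v)

/-- The map induced on chains by a map of points. -/
noncomputable def map (g : V → W) (n : ℕ) : AffineChain V n →ₗ[ℤ] AffineChain W n :=
  lift fun v => of (g ∘ v)

theorem bd_of {n : ℕ} (v : Fin (n + 1) → V) :
    bd n (of v) = ∑ i : Fin (n + 1), (-1 : ℤ) ^ (i : ℕ) • of (v ∘ i.succAbove) := lift_of _ _

theorem cone_of (b : V) {n : ℕ} (v : Fin n → V) : cone b n (of v) = of (Fin.cons b v) := lift_of _ _

theorem map_of (g : V → W) {n : ℕ} (v : Fin n → V) : map g n (of v) = of (g ∘ v) := lift_of _ _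

theorem cons_comp_succ_succAbove {n : ℕ} (b : V) (v : Fin (n + 1) → V) (i : Fin (n + 1)) :
    (Fin.cons b v : Fin (n + 2) → V) ∘ i.succ.succAbove = Fin.cons b (v ∘ i.succAbove) := by
  funext j
  refine Fin.cases ?_ (fun j => ?_) j
  · simp
  · simp

theorem bd_cone_zero (b : V) (c : AffineChain V 0) : bd 0 (cone b 0 c) = c := by
  suffices bd 0 ∘ₗ cone b 0 = LinearMap.id from LinearMap.congr_fun this c
  refine hom_ext fun v => ?_
  simp only [LinearMap.comp_apply, cone_of, bd_of, LinearMap.id_apply]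
  simp only [Fin.sum_univ_succ, Finset.univ_eq_empty, Finset.sum_empty]
  simp only [Fin.val_zero, pow_zero, one_smul, add_zero]
  congr 1

theorem bd_cone (b : V) {n : ℕ} (c : AffineChain V (n + 1)) :
    bd (n + 1) (cone b (n + 1) c) = c - cone b n (bd n c) := by
  suffices bd (n + 1) ∘ₗ cone b (n + 1) = LinearMap.id - cone b n ∘ₗ bd n from
    LinearMap.congr_fun this c
  refine hom_ext fun v => ?_
  simp only [LinearMap.comp_apply, LinearMap.sub_apply, cone_of, bd_of, LinearMap.id_apply]
  rw [Fin.sum_univ_succ, map_sum, sub_eq_add_neg, ← Finset.sum_neg_distrib]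
  congr 1
  · simp only [Fin.val_zero, pow_zero, one_smul]
    congr 1
  · refine Finset.sum_congr rfl fun i _ => ?_
    rw [cons_comp_succ_succAbove, map_smul, cone_of, Fin.val_succ, pow_succ]
    simp only [mul_neg, mul_one, neg_smul]

/-- Since every nonempty tuple is a cone, the cone formula for the boundary gives `bd_bd` by
induction without manipulating double sums. -/
theorem of_eq_cone {n : ℕ} (v : Fin (n + 1) → V) : of v = cone (v 0) n (of (Fin.tail v)) := by
  rw [cone_of, Fin.cons_self_tail]

theorem bd_bd : ∀ {n : ℕ} (c : AffineChain V (n + 2)), bd n (bd (n + 1) c) = 0 := by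
  intro n
  induction n with
  | zero =>
    intro c
    suffices bd 0 ∘ₗ bd 1 = (0 : AffineChain V 2 →ₗ[ℤ] AffineChain V 0) from
      LinearMap.congr_fun this c
    refine hom_ext fun v => ?_
    rw [LinearMap.comp_apply, of_eq_cone, bd_cone, map_sub, bd_cone_zero, sub_self,
      LinearMap.zero_apply]
  | succ n ih =>
    intro c
    suffices bd (n + 1) ∘ₗ bd (n + 2) = (0 : AffineChain V (n + 3) →ₗ[ℤ] AffineChain V (n + 1)) from
      LinearMap.congr_fun this c
    refine hom_ext fun v => ?_
    rw [LinearMap.comp_apply, of_eq_cone, bd_cone, map_sub, bd_cone, ih, map_zero, sub_zero,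
      sub_self, LinearMap.zero_apply]

theorem map_bd (g : V → W) {n : ℕ} (c : AffineChain V (n + 1)) :
    map g n (bd n c) = bd n (map g (n + 1) c) := by
  suffices map g n ∘ₗ bd n = bd n ∘ₗ map g (n + 1) from LinearMap.congr_fun this c
  refine hom_ext fun v => ?_
  simp only [LinearMap.comp_apply, map_of, bd_of, map_sum, map_smul]
  rfl

theorem map_cone (g : V → W) (b : V) {n : ℕ} (c : AffineChain V n) :
    map g (n + 1) (cone b n c) = cone (g b) n (map g n c) := by
  suffices map g (n + 1) ∘ₗ cone b n = cone (g b) n ∘ₗ map g n from LinearMap.congr_fun this c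
  refine hom_ext fun v => ?_
  simp only [LinearMap.comp_apply, map_of, cone_of]
  congr 1
  funext j
  refine Fin.cases ?_ (fun j => ?_) j <;> simp

/-! ### Barycentric subdivision and its chain homotopy to the identity. -/

variable [AddCommGroup V] [Module ℝ V] [AddCommGroup W] [Module ℝ W]

/-- The barycenter of a tuple. -/
noncomputable def bary {n : ℕ} (v : Fin n → V) : V := (n : ℝ)⁻¹ • ∑ i, v i

/-- Barycentric subdivision. -/
noncomputable def sd : ∀ n : ℕ, AffineChain V n →ₗ[ℤ] AffineChain V n
  | 0 => LinearMap.id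
  | n + 1 => lift fun v => cone (bary v) n (sd n (bd n (of v)))

/-- The chain homotopy from the identity to barycentric subdivision. -/
noncomputable def sdHomotopy : ∀ n : ℕ, AffineChain V n →ₗ[ℤ] AffineChain V (n + 1)
  | 0 => 0
  | n + 1 => lift fun v => cone (bary v) (n + 1) (of v - sdHomotopy n (bd n (of v)))

theorem sd_zero : sd 0 = (LinearMap.id : AffineChain V 0 →ₗ[ℤ] _) := rfl

theorem sd_of {n : ℕ} (v : Fin (n + 1) → V) :
    sd (n + 1) (of v) = cone (bary v) n (sd n (bd n (of v))) := lift_of _ _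

theorem sdHomotopy_of {n : ℕ} (v : Fin (n + 1) → V) :
    sdHomotopy (n + 1) (of v) = cone (bary v) (n + 1) (of v - sdHomotopy n (bd n (of v))) :=
  lift_of _ _

theorem bd_sd : ∀ {n : ℕ} (c : AffineChain V (n + 1)), bd n (sd (n + 1) c) = sd n (bd n c) := by
  intro n
  induction n with
  | zero =>
    intro c
    suffices bd 0 ∘ₗ sd 1 = sd 0 ∘ₗ (bd 0 : AffineChain V 1 →ₗ[ℤ] _) from
      LinearMap.congr_fun this c
    refine hom_ext fun v => ?_
    rw [LinearMap.comp_apply, sd_of, bd_cone_zero, LinearMap.comp_apply]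
  | succ n ih =>
    intro c
    suffices bd (n + 1) ∘ₗ sd (n + 2) = sd (n + 1) ∘ₗ (bd (n + 1) : AffineChain V (n + 2) →ₗ[ℤ] _)
      from LinearMap.congr_fun this c
    refine hom_ext fun v => ?_
    rw [LinearMap.comp_apply, sd_of, bd_cone, ih, bd_bd, map_zero, map_zero, sub_zero,
      LinearMap.comp_apply]

theorem bd_sdHomotopy : ∀ {n : ℕ} (c : AffineChain V (n + 1)),
    bd (n + 1) (sdHomotopy (n + 1) c) = c - sd (n + 1) c - sdHomotopy n (bd n c) := by
  intro n
  induction n with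
  | zero =>
    intro c
    suffices bd 1 ∘ₗ sdHomotopy 1 = LinearMap.id - sd 1 - sdHomotopy 0 ∘ₗ
      (bd 0 : AffineChain V 1 →ₗ[ℤ] _) from LinearMap.congr_fun this c
    refine hom_ext fun v => ?_
    simp only [LinearMap.comp_apply, LinearMap.sub_apply, LinearMap.id_apply]
    rw [sdHomotopy_of, bd_cone, sd_of]
    simp [sdHomotopy, sd_zero]
  | succ n ih =>
    intro c
    suffices bd (n + 2) ∘ₗ sdHomotopy (n + 2) = LinearMap.id - sd (n + 2) - sdHomotopy (n + 1) ∘ₗ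
      (bd (n + 1) : AffineChain V (n + 2) →ₗ[ℤ] _) from LinearMap.congr_fun this c
    refine hom_ext fun v => ?_
    simp only [LinearMap.comp_apply, LinearMap.sub_apply, LinearMap.id_apply]
    rw [sdHomotopy_of, bd_cone, sd_of, map_sub, ih, bd_bd, map_zero, sub_zero, sub_sub_cancel]
    abel

theorem map_bary (g : V →ₗ[ℝ] W) {n : ℕ} (v : Fin n → V) : g (bary v) = bary (g ∘ v) := by
  simp [bary]

theorem map_sd (g : V →ₗ[ℝ] W) : ∀ {n : ℕ} (c : AffineChain V n),
    map g n (sd n c) = sd n (map g n c) := by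
  intro n
  induction n with
  | zero => intro c; rfl
  | succ n ih =>
    intro c
    suffices map g (n + 1) ∘ₗ sd (n + 1) = sd (n + 1) ∘ₗ map g (n + 1) from
      LinearMap.congr_fun this c
    refine hom_ext fun v => ?_
    rw [LinearMap.comp_apply, LinearMap.comp_apply, sd_of, map_cone, ih, map_bd, map_of, sd_of,
      map_bary]

theorem bd_sd_iterate {n : ℕ} (k : ℕ) (c : AffineChain V (n + 1)) :
    bd n ((sd (n + 1))^[k] c) = (sd n)^[k] (bd n c) := by
  induction k with
  | zero => rfl
  | succ k ih => rw [Function.iterate_succ_apply', Function.iterate_succ_apply', bd_sd, ih]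

theorem map_sd_iterate (g : V →ₗ[ℝ] W) {n : ℕ} (k : ℕ) (c : AffineChain V n) :
    map g n ((sd n)^[k] c) = (sd n)^[k] (map g n c) := by
  induction k with
  | zero => rfl
  | succ k ih => rw [Function.iterate_succ_apply', Function.iterate_succ_apply', map_sd, ih]

end AffineChain

namespace AffineChain

/-! ### Chains supported on a family of tuples -/

section Supported

variable {V W : Type*}

/-- The chains that are combinations of tuples in `P`. -/
noncomputable def supported {n : ℕ} (P : Set (Fin n → V)) : Submodule ℤ (AffineChain V n) :=
  Submodule.span ℤ (of '' P)

theorem of_mem_supported {n : ℕ} {P : Set (Fin n → V)} {v : Fin n → V} (hv : v ∈ P) :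
    of v ∈ supported P := Submodule.subset_span ⟨v, hv, rfl⟩

theorem supported_mono {n : ℕ} {P Q : Set (Fin n → V)} (h : P ⊆ Q) : supported P ≤ supported Q :=
  Submodule.span_mono (Set.image_mono h)

theorem apply_mem_of_supported {n : ℕ} {M : Type*} [AddCommGroup M] {P : Set (Fin n → V)}
    (f : AffineChain V n →ₗ[ℤ] M) (S : Submodule ℤ M) (h : ∀ v ∈ P, f (of v) ∈ S)
    {c : AffineChain V n} (hc : c ∈ supported P) : f c ∈ S := by
  have : supported P ≤ S.comap f := by
    refine Submodule.span_le.2 ?_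
    rintro _ ⟨v, hv, rfl⟩
    exact h v hv
  exact this hc

theorem apply_eq_zero_of_supported {n : ℕ} {M : Type*} [AddCommGroup M] {P : Set (Fin n → V)}
    (f : AffineChain V n →ₗ[ℤ] M) (h : ∀ v ∈ P, f (of v) = 0)
    {c : AffineChain V n} (hc : c ∈ supported P) : f c = 0 := by
  simpa using apply_mem_of_supported f ⊥ (by simpa using h) hc

theorem cone_mem_supported (b : V) {n : ℕ} {P : Set (Fin n → V)} {Q : Set (Fin (n + 1) → V)}
    (h : ∀ v ∈ P, Fin.cons b v ∈ Q) {c : AffineChain V n} (hc : c ∈ supported P) :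
    cone b n c ∈ supported Q :=
  apply_mem_of_supported _ _ (fun v hv => by rw [cone_of]; exact of_mem_supported (h v hv)) hc

theorem bd_of_mem_supported {n : ℕ} {v : Fin (n + 1) → V} {P : Set (Fin n → V)}
    (h : ∀ i : Fin (n + 1), v ∘ i.succAbove ∈ P) : bd n (of v) ∈ supported P := by
  rw [bd_of]
  exact Submodule.sum_mem _ fun i _ => Submodule.smul_mem _ _ (of_mem_supported (h i))

theorem forall_cons_mem {A : Set V} {b : V} (hb : b ∈ A) {n : ℕ} {v : Fin n → V}
    (hv : ∀ j, v j ∈ A) : ∀ j, (Fin.cons b v : Fin (n + 1) → V) j ∈ A := by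
  intro j
  refine Fin.cases ?_ (fun j => ?_) j
  · simpa using hb
  · simpa using hv j

end Supported

section Convex

variable {V : Type*} [AddCommGroup V] [Module ℝ V]

theorem bary_mem {A : Set V} (hA : Convex ℝ A) {n : ℕ} {v : Fin (n + 1) → V} (hv : ∀ j, v j ∈ A) :
    bary v ∈ A := by
  rw [bary, Finset.smul_sum]
  refine hA.sum_mem (fun _ _ => by positivity) ?_ fun j _ => hv j
  rw [Finset.sum_const, Finset.card_univ, Fintype.card_fin, nsmul_eq_mul]
  exact mul_inv_cancel₀ (by positivity)

theorem sdHomotopy_of_mem_supported {A : Set V} (hA : Convex ℝ A) : ∀ {n : ℕ} {v : Fin n → V},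
    (∀ j, v j ∈ A) → sdHomotopy n (of v) ∈ supported {w : Fin (n + 1) → V | ∀ j, w j ∈ A} := by
  intro n
  induction n with
  | zero => intro v _; exact Submodule.zero_mem _
  | succ n ih =>
    intro v hv
    rw [sdHomotopy_of]
    refine cone_mem_supported (P := {w | ∀ j, w j ∈ A})
      (Q := {w : Fin (n + 2) → V | ∀ j, w j ∈ A}) _
      (fun w hw => forall_cons_mem (bary_mem hA hv) hw) ?_
    refine Submodule.sub_mem _ (of_mem_supported hv) ?_
    exact apply_mem_of_supported (sdHomotopy n) _ (fun w hw => ih hw)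
      (bd_of_mem_supported (P := {w | ∀ j, w j ∈ A}) fun i j => hv _)

end Convex

/-! ### Subdivision shrinks diameters. -/

section Normed

variable {V : Type*} [NormedAddCommGroup V] [NormedSpace ℝ V]

theorem dist_bary_le {n : ℕ} {v : Fin (n + 1) → V} {d : ℝ} (hv : ∀ i j, dist (v i) (v j) ≤ d)
    (i : Fin (n + 1)) : dist (v i) (bary v) ≤ n / (n + 1) * d := by
  have h : v i - bary v = ((n + 1 : ℕ) : ℝ)⁻¹ • ∑ j, (v i - v j) := by
    rw [Finset.sum_sub_distrib, smul_sub, bary, Finset.sum_const, Finset.card_univ,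
      Fintype.card_fin, ← Nat.cast_smul_eq_nsmul ℝ, smul_smul, inv_mul_cancel₀ (by positivity),
      one_smul]
  have h2 : ‖∑ j, (v i - v j)‖ ≤ n * d := by
    rw [Fin.sum_univ_succAbove _ i, sub_self, zero_add]
    refine (norm_sum_le_of_le _ fun j _ => ?_).trans_eq (b := ∑ _j : Fin n, d) (by simp)
    rw [← dist_eq_norm]
    exact hv _ _
  rw [dist_eq_norm, h, norm_smul, norm_inv, Real.norm_natCast, Nat.cast_succ]
  calc ((n : ℝ) + 1)⁻¹ * ‖∑ j, (v i - v j)‖ ≤ ((n : ℝ) + 1)⁻¹ * (n * d) := by gcongr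
    _ = n / (n + 1) * d := by ring

/-- New edges either come from a subdivided face or join the barycenter to a point of the hull. The
ratio is fixed by `N` instead of `n` so that the induction can pass to faces with the same constant.
-/
theorem sd_of_mem_supported (N : ℕ) {A : Set V} (hA : Convex ℝ A) : ∀ {n : ℕ}, n ≤ N + 1 →
    ∀ {v : Fin n → V} {d : ℝ}, (∀ j, v j ∈ A) → (∀ i j, dist (v i) (v j) ≤ d) →
    sd n (of v) ∈ supported
      {w | (∀ j, w j ∈ A) ∧ ∀ i j, dist (w i) (w j) ≤ (N / (N + 1) : ℝ) * d} := by
  intro n hn v d hv hd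
  -- Shrinking `A` to the hull of `v` lets a ball around the barycenter bound the edges at the apex.
  suffices H : sd n (of v) ∈ supported {w | (∀ j, w j ∈ convexHull ℝ (Set.range v)) ∧
      ∀ i j, dist (w i) (w j) ≤ (N / (N + 1) : ℝ) * d} by
    refine supported_mono ?_ H
    rintro w ⟨hw, hw'⟩
    exact ⟨fun j => convexHull_min (Set.range_subset_iff.2 hv) hA (hw j), hw'⟩
  clear hv hA A
  induction n with
  | zero => exact of_mem_supported ⟨fun j => j.elim0, fun j => j.elim0⟩
  | succ n ih =>
    have hd0 : 0 ≤ d := dist_nonneg.trans (hd 0 0)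
    have hball : convexHull ℝ (Set.range v) ⊆
        Metric.closedBall (bary v) ((N / (N + 1) : ℝ) * d) := by
      refine convexHull_min ?_ (convex_closedBall _ _)
      rintro _ ⟨i, rfl⟩
      refine (dist_bary_le hd i).trans ?_
      gcongr ?_ * d
      rw [div_le_div_iff₀ (by positivity) (by positivity)]
      have : (n : ℝ) ≤ N := by exact_mod_cast Nat.le_of_succ_le_succ hn
      nlinarith
    have hb : bary v ∈ convexHull ℝ (Set.range v) :=
      bary_mem (convex_convexHull ℝ _) fun j => subset_convexHull ℝ _ ⟨j, rfl⟩
    rw [sd_of]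
    refine cone_mem_supported (P := {w | (∀ j, w j ∈ convexHull ℝ (Set.range v)) ∧
      ∀ i j, dist (w i) (w j) ≤ (N / (N + 1) : ℝ) * d}) _ ?_ ?_
    · rintro w ⟨hw, hw'⟩
      refine ⟨forall_cons_mem hb hw, fun i j => ?_⟩
      refine Fin.cases ?_ (fun i => ?_) i <;> refine Fin.cases ?_ (fun j => ?_) j
      · simp only [dist_self]; positivity
      · simpa [dist_comm] using hball (hw j)
      · simpa using hball (hw i)
      · simpa using hw' i j
    · rw [bd_of, map_sum]
      refine Submodule.sum_mem _ fun i _ => ?_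
      rw [map_smul]
      refine Submodule.smul_mem _ _ ?_
      refine supported_mono ?_ (ih (by omega) (v := v ∘ i.succAbove) fun _ _ => hd _ _)
      rintro w ⟨hw, hw'⟩
      exact ⟨fun j => convexHull_mono (Set.range_comp_subset_range _ _) (hw j), hw'⟩

theorem sd_iterate_mem_supported {n : ℕ} {A : Set V} (hA : Convex ℝ A) {d : ℝ} (k : ℕ)
    {c : AffineChain V n}
    (hc : c ∈ supported {w | (∀ j, w j ∈ A) ∧ ∀ i j, dist (w i) (w j) ≤ d}) :
    (sd n)^[k] c ∈ supported
      {w | (∀ j, w j ∈ A) ∧ ∀ i j, dist (w i) (w j) ≤ (n / (n + 1) : ℝ) ^ k * d} := by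
  induction k with
  | zero => simpa using hc
  | succ k ih =>
    rw [Function.iterate_succ_apply']
    refine apply_mem_of_supported (sd n) _ (fun w hw => ?_) ih
    rw [pow_succ', mul_assoc]
    exact sd_of_mem_supported n hA (by omega) hw.1 hw.2

end Normed

/-! ### The cocycle attached to a labelling -/

section Label

variable {V : Type*}

/-- The matrix of the labels of a tuple; the label `0` gives a zero row. -/
def labelMatrix {m n : ℕ} (L : V → Fin (n + 2)) (v : Fin m → V) : Matrix (Fin m) (Fin (n + 1)) ℤ :=
  Matrix.of fun j k => if L (v j) = k.succ then 1 else 0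

/-- The cochain counting tuples whose labels are `1, …, n + 1`, with signs. -/
noncomputable def labelCochain {n : ℕ} (L : V → Fin (n + 2)) : AffineChain V (n + 1) →ₗ[ℤ] ℤ :=
  lift fun v => (labelMatrix L v).det

theorem labelCochain_of {n : ℕ} (L : V → Fin (n + 2)) (v : Fin (n + 1) → V) :
    labelCochain L (of v) = (labelMatrix L v).det := lift_of _ _

theorem labelCochain_map {W : Type*} {n : ℕ} (L : W → Fin (n + 2)) (g : V → W)
    (c : AffineChain V (n + 1)) : labelCochain L (map g _ c) = labelCochain (L ∘ g) c := by
  suffices labelCochain L ∘ₗ map g _ = labelCochain (L ∘ g) from LinearMap.congr_fun this c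
  refine hom_ext fun v => ?_
  rw [LinearMap.comp_apply, map_of, labelCochain_of, labelCochain_of]
  rfl

/-- Laplace expansion along a first column of ones. -/
theorem labelCochain_bd_of {n : ℕ} (L : V → Fin (n + 2)) (v : Fin (n + 2) → V) :
    labelCochain L (bd (n + 1) (of v)) = (Matrix.of fun j : Fin (n + 2) =>
      (Fin.cons 1 (labelMatrix L v j) : Fin (n + 2) → ℤ)).det := by
  rw [bd_of, map_sum, Matrix.det_succ_column_zero]
  refine Finset.sum_congr rfl fun i _ => ?_
  rw [map_smul, labelCochain_of, Matrix.of_apply, Fin.cons_zero, mul_one, smul_eq_mul]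
  congr 2

/-- By pigeonhole a missing label forces a repeated one, so the determinant has two equal rows. -/
theorem labelCochain_bd_of_eq_zero {n : ℕ} (L : V → Fin (n + 2)) (v : Fin (n + 2) → V)
    (h : ∃ i, ∀ j, L (v j) ≠ i) : labelCochain L (bd (n + 1) (of v)) = 0 := by
  have hns : ¬ Function.Surjective (L ∘ v) := fun hs => by
    obtain ⟨i, hi⟩ := h
    obtain ⟨j, hj⟩ := hs i
    exact hi j hj
  have hni : ¬ Function.Injective (L ∘ v) := fun hi => hns (Finite.surjective_of_injective hi)
  simp only [Function.Injective, not_forall] at hni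
  obtain ⟨i, j, hij, hne⟩ := hni
  rw [labelCochain_bd_of]
  refine Matrix.det_zero_of_row_eq hne ?_
  funext k
  refine Fin.cases ?_ (fun k => ?_) k
  · simp
  · simp only [Function.comp_apply] at hij
    simp [labelMatrix, hij]

theorem labelCochain_bd_of_eq_one {n : ℕ} (L : V → Fin (n + 2)) (v : Fin (n + 2) → V)
    (h : ∀ j, L (v j) = j) : labelCochain L (bd (n + 1) (of v)) = 1 := by
  rw [labelCochain_bd_of, Matrix.det_of_isLowerTriangular]
  · refine Finset.prod_eq_one fun i _ => ?_
    refine Fin.cases ?_ (fun k => ?_) i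
    · simp
    · simp [labelMatrix, h]
  · intro i j hij
    change i < j at hij
    revert hij
    refine Fin.cases ?_ (fun k => ?_) j
    · intro h; exact absurd h (Fin.not_lt_zero _)
    · intro hik
      simp [labelMatrix, h, hik.ne]

/-- Sperner's lemma, for iterated barycentric subdivisions. -/
theorem labelCochain_sd_iterate_bd {V : Type*} [NormedAddCommGroup V] [NormedSpace ℝ V] {n : ℕ}
    (L : V → Fin (n + 2)) (v : Fin (n + 2) → V) (hv : ∀ j, L (v j) = j)
    (hL : ∀ i : Fin (n + 2), ∀ y ∈ convexHull ℝ (Set.range (v ∘ i.succAbove)), L y ≠ i) (k : ℕ) :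
    labelCochain L ((sd (n + 1))^[k] (bd (n + 1) (of v))) = 1 := by
  set P : ∀ m : ℕ, Set (Fin m → V) := fun m =>
    {w | ∃ i : Fin (n + 2), ∀ j, w j ∈ convexHull ℝ (Set.range (v ∘ i.succAbove))} with hP
  have hsupp : ∀ k, (sd (n + 1))^[k] (bd (n + 1) (of v)) ∈ supported (P (n + 1)) := by
    intro k
    induction k with
    | zero =>
      exact bd_of_mem_supported fun i => ⟨i, fun j => subset_convexHull ℝ _ ⟨j, rfl⟩⟩
    | succ k ih =>
      rw [Function.iterate_succ_apply']
      refine apply_mem_of_supported (sd (n + 1)) _ ?_ ih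
      rintro w ⟨i, hw⟩
      obtain ⟨d, hd⟩ := (Set.finite_range fun p : Fin (n + 1) × Fin (n + 1) =>
        dist (w p.1) (w p.2)).bddAbove
      refine supported_mono ?_ (sd_of_mem_supported (n + 1) (convex_convexHull ℝ _) (by omega)
        (d := d) hw fun a b =>
          hd ⟨(a, b), rfl⟩)
      exact fun u hu => ⟨i, hu.1⟩
  induction k with
  | zero => exact labelCochain_bd_of_eq_one L v hv
  | succ k ih =>
    set c := (sd (n + 1))^[k] (bd (n + 1) (of v)) with hc
    have hbd : bd n c = 0 := by
      rw [hc, bd_sd_iterate, bd_bd, Function.iterate_fixed (map_zero _)]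
    -- As `c` is a cycle, it differs from its subdivision by the boundary of a chain whose tuples
    -- each lie in one face; there a label is missing, so the count does not change.
    have hT := bd_sdHomotopy c
    rw [hbd, map_zero, sub_zero] at hT
    have hTc : sdHomotopy (n + 1) c ∈ supported (P (n + 2)) := by
      refine apply_mem_of_supported (sdHomotopy (n + 1)) _ ?_ (hsupp k)
      rintro w ⟨i, hw⟩
      refine supported_mono ?_ (sdHomotopy_of_mem_supported (convex_convexHull ℝ _) hw)
      exact fun u hu => ⟨i, hu⟩
    have h0 : labelCochain L (bd (n + 1) (sdHomotopy (n + 1) c)) = 0 := by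
      refine apply_eq_zero_of_supported (labelCochain L ∘ₗ bd (n + 1)) ?_ hTc
      rintro w ⟨i, hw⟩
      exact labelCochain_bd_of_eq_zero L w ⟨i, fun j => hL i _ (hw j)⟩
    rw [hT, map_sub, ih, sub_eq_zero] at h0
    rw [Function.iterate_succ_apply', ← hc, ← h0]

end Label

end AffineChain

/-! ### Elements of homology groups -/

namespace ChainComplex

variable (K : ChainComplex AddCommGrpCat.{0} ℕ) (n : ℕ)

theorem homologyπ_surjective : Function.Surjective (K.homologyπ n) :=
  (AddCommGrpCat.epi_iff_surjective _).1 inferInstance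

theorem iCycles_injective : Function.Injective (K.iCycles n) :=
  (AddCommGrpCat.mono_iff_injective _).1 inferInstance

theorem homologyπ_eq_zero_iff (x : K.cycles n) :
    K.homologyπ n x = 0 ↔ ∃ c : K.X (n + 1), K.d (n + 1) n c = K.iCycles n x := by
  constructor
  · intro hx
    have hex : (ShortComplex.mk _ _ (K.toCycles_comp_homologyπ (n + 1) n)).Exact :=
      ShortComplex.exact_of_g_is_cokernel _ (K.homologyIsCokernel (n + 1) n (by simp))
    obtain ⟨c, hc⟩ := (ShortComplex.ab_exact_iff _).1 hex x hx
    refine ⟨c, ?_⟩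
    rw [← hc, ← ConcreteCategory.comp_apply]
    exact (ConcreteCategory.congr_hom (K.toCycles_i (n + 1) n) c).symm
  · rintro ⟨c, hc⟩
    have : K.toCycles (n + 1) n c = x := by
      apply iCycles_injective
      rw [← hc, ← ConcreteCategory.comp_apply, K.toCycles_i]
    rw [← this, ← ConcreteCategory.comp_apply, K.toCycles_comp_homologyπ]
    rfl

theorem exists_iCycles_eq (z : K.X n) (hz : ∀ j, K.d n j z = 0) :
    ∃ x : K.cycles n, K.iCycles n x = z := by
  -- Elements are morphisms from ℤ, which turns the universal property of cycles into a statement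
  -- about `z`.
  let k : AddCommGrpCat.of ℤ ⟶ K.X n := AddCommGrpCat.ofHom (zmultiplesHom _ z)
  have hk : k ≫ K.d n ((ComplexShape.down ℕ).next n) = 0 := by
    ext
    simp [k, hz]
  refine ⟨K.liftCycles k _ rfl hk (1 : ℤ), ?_⟩
  rw [← ConcreteCategory.comp_apply, K.liftCycles_i]
  simp [k]

variable {K n} {L : ChainComplex AddCommGrpCat.{0} ℕ} (φ : K ⟶ L)

theorem homologyMap_homologyπ (x : K.cycles n) :
    HomologicalComplex.homologyMap φ n (K.homologyπ n x) =
      L.homologyπ n (HomologicalComplex.cyclesMap φ n x) := by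
  rw [← ConcreteCategory.comp_apply, HomologicalComplex.homologyπ_naturality,
    ConcreteCategory.comp_apply]

theorem iCycles_cyclesMap (x : K.cycles n) :
    L.iCycles n (HomologicalComplex.cyclesMap φ n x) = φ.f n (K.iCycles n x) := by
  rw [← ConcreteCategory.comp_apply, HomologicalComplex.cyclesMap_i, ConcreteCategory.comp_apply]

theorem d_f_apply (i j : ℕ) (c : K.X i) : L.d i j (φ.f i c) = φ.f j (K.d i j c) := by
  rw [← ConcreteCategory.comp_apply, φ.comm, ConcreteCategory.comp_apply]

end ChainComplex

/-! ### Singular chains -/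

namespace SingularChain

open Simplicial

/-- The singular chain complex with integer coefficients. -/
noncomputable abbrev complex (X : TopCat.{0}) : ChainComplex AddCommGrpCat.{0} ℕ :=
  (TopCat.toSSet.obj X).chainComplex (AddCommGrpCat.of ℤ)

/-- The map of singular chain complexes induced by a continuous map. -/
noncomputable abbrev complexMap {X Y : TopCat.{0}} (g : X ⟶ Y) : complex X ⟶ complex Y :=
  SSet.chainComplexMap (TopCat.toSSet.map g) (AddCommGrpCat.of ℤ)

/-- A continuous map from the standard simplex as a singular simplex. -/
noncomputable def simplex {X : TopCat.{0}} {n : ℕ} (σ : C(stdSimplex ℝ (Fin (n + 1)), X)) :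
    (TopCat.toSSet.obj X) _⦋n⦌ :=
  (X.toSSetObjEquiv (.op ⦋n⦌)).symm σ

/-- A singular simplex as a singular chain. -/
noncomputable def of {X : TopCat.{0}} {n : ℕ} (σ : C(stdSimplex ℝ (Fin (n + 1)), X)) :
    (complex X).X n :=
  (TopCat.toSSet.obj X).ιChainComplex (R := AddCommGrpCat.of ℤ) (simplex σ) (1 : ℤ)

/-- The `i`-th face of a singular simplex. -/
noncomputable def face {X : Type*} [TopologicalSpace X] {n : ℕ} (i : Fin (n + 2))
    (σ : C(stdSimplex ℝ (Fin (n + 2)), X)) : C(stdSimplex ℝ (Fin (n + 1)), X) :=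
  σ.comp ⟨stdSimplex.map i.succAbove, stdSimplex.continuous_map _⟩

theorem simplex_surjective {X : TopCat.{0}} {n : ℕ} : Function.Surjective (simplex (X := X) (n := n)) :=
  (X.toSSetObjEquiv (.op ⦋n⦌)).symm.surjective

theorem map_simplex {X Y : TopCat.{0}} (g : X ⟶ Y) {n : ℕ} (σ : C(stdSimplex ℝ (Fin (n + 1)), X)) :
    (TopCat.toSSet.map g).app _ (simplex σ) = simplex (g.hom.comp σ) := rfl

theorem complexMap_of {X Y : TopCat.{0}} (g : X ⟶ Y) {n : ℕ}
    (σ : C(stdSimplex ℝ (Fin (n + 1)), X)) : (complexMap g).f n (of σ) = of (g.hom.comp σ) := by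
  rw [of, of, ← map_simplex, ← SSet.ι_chainComplexMap_f, ConcreteCategory.comp_apply]

theorem d_of {X : TopCat.{0}} {n : ℕ} (σ : C(stdSimplex ℝ (Fin (n + 2)), X)) :
    (complex X).d (n + 1) n (of σ) = ∑ i : Fin (n + 2), (-1 : ℤ) ^ (i : ℕ) • of (face i σ) := by
  rw [of, ← ConcreteCategory.comp_apply, SSet.ιChainComplex_d]
  let ev : (AddCommGrpCat.of ℤ ⟶ (complex X).X n) →+ (complex X).X n :=
    ⟨⟨fun f => f (1 : ℤ), rfl⟩, fun _ _ => rfl⟩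
  refine (map_sum ev _ _).trans (Finset.sum_congr rfl fun i _ => ?_)
  exact map_zsmul ev _ _

theorem hom_ext {X : TopCat.{0}} {n : ℕ} {G : AddCommGrpCat.{0}} {f g : (complex X).X n ⟶ G}
    (h : ∀ σ, f (of σ) = g (of σ)) : f = g := by
  refine SSet.chainComplex_hom_ext fun s => ?_
  obtain ⟨σ, rfl⟩ := simplex_surjective s
  ext
  exact h σ

/-- The quotient by the generated subgroup kills all simplices, so `hom_ext` makes the projection
zero. -/
theorem mem_closure {X : TopCat.{0}} {n : ℕ} (c : (complex X).X n) :
    c ∈ AddSubgroup.closure (Set.range (of (X := X) (n := n))) := by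
  set H := AddSubgroup.closure (Set.range (of (X := X) (n := n)))
  have : AddCommGrpCat.ofHom (QuotientAddGroup.mk' H) = 0 := by
    refine hom_ext fun σ => ?_
    exact (QuotientAddGroup.eq_zero_iff _).2 (AddSubgroup.subset_closure ⟨σ, rfl⟩)
  exact (QuotientAddGroup.eq_zero_iff c).1 (ConcreteCategory.congr_hom this c)

theorem induction_on {X : TopCat.{0}} {n : ℕ} {p : (complex X).X n → Prop} (c : (complex X).X n)
    (of : ∀ σ, p (of σ)) (zero : p 0) (add : ∀ a b, p a → p b → p (a + b))
    (neg : ∀ a, p a → p (-a)) : p c := by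
  refine AddSubgroup.closure_induction (p := fun c _ => p c) ?_ zero (fun a b _ _ => add a b)
    (fun a _ => neg a) (mem_closure c)
  rintro _ ⟨σ, rfl⟩
  exact of σ

/-- The homomorphism with prescribed values on singular simplices. -/
noncomputable def desc {X : TopCat.{0}} {n : ℕ} (g : C(stdSimplex ℝ (Fin (n + 1)), X) → ℤ) :
    (complex X).X n ⟶ AddCommGrpCat.of ℤ :=
  Limits.Cofan.IsColimit.desc ((TopCat.toSSet.obj X).isColimitChainComplexXCofan _ n) fun s =>
    AddCommGrpCat.ofHom (zmultiplesHom ℤ (g (X.toSSetObjEquiv (.op ⦋n⦌) s)))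

theorem desc_of {X : TopCat.{0}} {n : ℕ} (g : C(stdSimplex ℝ (Fin (n + 1)), X) → ℤ)
    (σ : C(stdSimplex ℝ (Fin (n + 1)), X)) : desc g (of σ) = g σ := by
  rw [of, ← ConcreteCategory.comp_apply, desc]
  refine (ConcreteCategory.congr_hom (Limits.Cofan.IsColimit.fac
    ((TopCat.toSSet.obj X).isColimitChainComplexXCofan (AddCommGrpCat.of ℤ) n) _
      (simplex σ)) (1 : ℤ)).trans ?_
  simp [simplex]

theorem complexMap_f_injective {X Y : TopCat.{0}} (g : X ⟶ Y) (hg : Function.Injective g) (n : ℕ) :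
    Function.Injective ((complexMap g).f n) := by
  have : Mono g := (TopCat.mono_iff_injective g).2 hg
  have h : Mono (((AlgebraicTopology.singularChainComplexFunctor AddCommGrpCat.{0}).obj
    (AddCommGrpCat.of ℤ)).map g) := inferInstance
  have h' : Mono (complexMap g) := h
  exact (AddCommGrpCat.mono_iff_injective _).1 inferInstance

theorem complexMap_comp_f_apply {X Y Z : TopCat.{0}} (g : X ⟶ Y) (h : Y ⟶ Z) {n : ℕ}
    (c : (complex X).X n) :
    (complexMap (g ≫ h)).f n c = (complexMap h).f n ((complexMap g).f n c) := by
  rw [complexMap, Functor.map_comp]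
  simp [SSet.chainComplexMap]

/-- Every singular chain is carried by a compact set. -/
theorem exists_isCompact {Y : Type} [TopologicalSpace Y] {A : Set Y} {n : ℕ}
    (c : (complex (TopCat.of A)).X n) :
    ∃ (K : Set Y) (hK : K ⊆ A), IsCompact K ∧
      ∃ c' : (complex (TopCat.of K)).X n, (complexMap (subspaceIncl hK)).f n c' = c := by
  induction c using induction_on with
  | of σ =>
    let σ' : C(stdSimplex ℝ (Fin (n + 1)), Y) := ⟨fun y => (σ y : A), by fun_prop⟩
    refine ⟨Set.range σ', ?_, isCompact_range σ'.continuous,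
      of ⟨fun y => ⟨σ' y, y, rfl⟩, by fun_prop⟩, ?_⟩
    · rintro _ ⟨y, rfl⟩
      exact (σ y : A).2
    · rw [complexMap_of]
      rfl
  | zero => exact ⟨∅, Set.empty_subset _, isCompact_empty, 0, map_zero _⟩
  | add a b ha hb =>
    obtain ⟨K, hK, hKc, a', rfl⟩ := ha
    obtain ⟨K', hK', hKc', b', rfl⟩ := hb
    refine ⟨K ∪ K', Set.union_subset hK hK', hKc.union hKc',
      (complexMap (subspaceIncl Set.subset_union_left)).f n a' +
        (complexMap (subspaceIncl Set.subset_union_right)).f n b', ?_⟩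
    rw [map_add, ← complexMap_comp_f_apply, ← complexMap_comp_f_apply]
    rfl
  | neg a ha =>
    obtain ⟨K, hK, hKc, a', rfl⟩ := ha
    exact ⟨K, hK, hKc, -a', map_neg _ _⟩

theorem singularHomologyZ_map {X Y : TopCat.{0}} (g : X ⟶ Y) (n : ℕ) :
    (singularHomologyZ n).map g = HomologicalComplex.homologyMap (complexMap g) n := rfl

/-- A homology class vanishing in `A` vanishes in the union of its domain and a compact
subset of `A`. -/
theorem exists_isCompact_map_eq_zero {Y : Type} [TopologicalSpace Y] {A B : Set Y} (h : B ⊆ A)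
    {n : ℕ} (a : (singularHomologyZ n).obj (TopCat.of B))
    (ha : (singularHomologyZ n).map (subspaceIncl h) a = 0) :
    ∃ K ⊆ A, IsCompact K ∧
      (singularHomologyZ n).map (subspaceIncl (Set.subset_union_left : B ⊆ B ∪ K)) a = 0 := by
  obtain ⟨x, rfl⟩ := ChainComplex.homologyπ_surjective (complex (TopCat.of B)) n a
  rw [singularHomologyZ_map] at ha
  erw [ChainComplex.homologyMap_homologyπ, ChainComplex.homologyπ_eq_zero_iff] at ha
  obtain ⟨c, hc⟩ := ha
  obtain ⟨K, hK, hKc, c', rfl⟩ := exists_isCompact c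
  refine ⟨K, hK, hKc, ?_⟩
  rw [singularHomologyZ_map]
  erw [ChainComplex.homologyMap_homologyπ, ChainComplex.homologyπ_eq_zero_iff]
  refine ⟨(complexMap (subspaceIncl Set.subset_union_right)).f (n + 1) c', ?_⟩
  have hBK : B ∪ K ⊆ A := Set.union_subset h hK
  -- Chains of `B ∪ K` embed in chains of `A`, where the bounding relation is already known.
  refine complexMap_f_injective (subspaceIncl hBK) (Set.inclusion_injective hBK) n ?_
  rw [← ChainComplex.d_f_apply, ← complexMap_comp_f_apply]
  refine hc.trans ?_
  rw [ChainComplex.iCycles_cyclesMap, ChainComplex.iCycles_cyclesMap, ← complexMap_comp_f_apply]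
  rfl

end SingularChain

/-! ### The fundamental class of the boundary of a cube -/

namespace AffineChain

theorem exists_dist_le {V : Type*} [PseudoMetricSpace V] {n : ℕ} (v : Fin n → V) :
    ∃ d : ℝ, ∀ i j, dist (v i) (v j) ≤ d := by
  obtain ⟨d, hd⟩ := (Set.finite_range fun p : Fin n × Fin n => dist (v p.1) (v p.2)).bddAbove
  exact ⟨d, fun i j => hd ⟨(i, j), rfl⟩⟩

theorem labelCochain_congr {V : Type*} {n : ℕ} {L L' : V → Fin (n + 2)} {A : Set V}
    (h : ∀ y ∈ A, L y = L' y) {c : AffineChain V (n + 1)}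
    (hc : c ∈ supported {w : Fin (n + 1) → V | ∀ j, w j ∈ A}) :
    labelCochain L c = labelCochain L' c := by
  rw [← sub_eq_zero, ← LinearMap.sub_apply]
  refine apply_eq_zero_of_supported _ (fun w hw => ?_) hc
  rw [LinearMap.sub_apply, sub_eq_zero, labelCochain_of, labelCochain_of]
  congr 1
  ext j k
  simp only [labelMatrix, Matrix.of_apply, h _ (hw j)]

/-- The tuple of the vertices of the standard simplex. -/
noncomputable def vertices (n : ℕ) : Fin n → Fin n → ℝ := fun i => Pi.single i 1

theorem vertices_mem (n : ℕ) (i : Fin n) : vertices n i ∈ stdSimplex ℝ (Fin n) :=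
  single_mem_stdSimplex ℝ i

theorem sd_iterate_vertices_mem (n : ℕ) : ∃ d : ℝ, ∀ k,
    (sd n)^[k] (of (vertices n)) ∈ supported {w : Fin n → Fin n → ℝ |
      (∀ j, w j ∈ stdSimplex ℝ (Fin n)) ∧ ∀ i j, dist (w i) (w j) ≤ (n / (n + 1) : ℝ) ^ k * d} := by
  obtain ⟨d, hd⟩ := exists_dist_le (vertices n)
  exact ⟨d, fun k => sd_iterate_mem_supported (convex_stdSimplex ℝ _) k
    (of_mem_supported ⟨vertices_mem n, hd⟩)⟩

/-- Subdivision is natural for the linear face inclusions, so counts on separate faces assemble into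
one count on the boundary of the simplex. -/
theorem sum_labelCochain_face {n : ℕ} {L : (Fin (n + 2) → ℝ) → Fin (n + 2)}
    {L' : Fin (n + 2) → (Fin (n + 1) → ℝ) → Fin (n + 2)}
    (h : ∀ i, ∀ y ∈ stdSimplex ℝ (Fin (n + 1)),
      L' i y = L (FunOnFinite.linearMap ℝ ℝ i.succAbove y)) (k : ℕ) :
    ∑ i : Fin (n + 2), (-1 : ℤ) ^ (i : ℕ) •
      labelCochain (L' i) ((sd (n + 1))^[k] (of (vertices (n + 1)))) =
    labelCochain L ((sd (n + 1))^[k] (bd (n + 1) (of (vertices (n + 2))))) := by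
  obtain ⟨d, hd⟩ := sd_iterate_vertices_mem (n + 1)
  rw [bd_of, ← Module.End.pow_apply, ← Module.End.pow_apply, map_sum, map_sum]
  refine Finset.sum_congr rfl fun i _ => ?_
  rw [map_smul, map_smul]
  congr 1
  have hv : vertices (n + 2) ∘ i.succAbove =
      FunOnFinite.linearMap ℝ ℝ i.succAbove ∘ vertices (n + 1) := by
    funext j
    simp [vertices]
  rw [Module.End.pow_apply, Module.End.pow_apply, hv, ← map_of, ← map_sd_iterate, labelCochain_map]
  refine labelCochain_congr (h i) (supported_mono ?_ (hd k))
  exact fun w hw => hw.1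

end AffineChain

namespace CubeBoundary

open AffineChain

variable {n : ℕ}

theorem exists_label (x : Fin (n + 1) → ℝ) :
    ∃ i, ∀ j, (Fin.cons 0 x : Fin (n + 2) → ℝ) j ≤ (Fin.cons 0 x : Fin (n + 2) → ℝ) i :=
  Finite.exists_max _

/-- The label of a point: the position of a largest entry among `0` and its coordinates. -/
noncomputable def label (x : Fin (n + 1) → ℝ) : Fin (n + 2) := (exists_label x).choose

theorem le_label (x : Fin (n + 1) → ℝ) (j : Fin (n + 2)) :
    (Fin.cons 0 x : Fin (n + 2) → ℝ) j ≤ (Fin.cons 0 x : Fin (n + 2) → ℝ) (label x) :=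
  (exists_label x).choose_spec j

theorem abs_cons_sub_le (x y : Fin (n + 1) → ℝ) (i : Fin (n + 2)) :
    |(Fin.cons 0 x : Fin (n + 2) → ℝ) i - (Fin.cons 0 y : Fin (n + 2) → ℝ) i| ≤ dist x y := by
  refine Fin.cases ?_ (fun i => ?_) i
  · simp
  · simpa [Real.dist_eq] using dist_le_pi_dist x y i

/-- If every label occurred, each entry of `(0, p j₀)` would be within 2 · 1/4 of the maximum. As 0
is an entry, the norm would be at most 1/2. -/
theorem exists_label_ne {ι : Type*} [Nonempty ι] {p : ι → Fin (n + 1) → ℝ} (hp : ∀ j, ‖p j‖ = 1)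
    (hd : ∀ i j, dist (p i) (p j) ≤ 1 / 4) : ∃ i, ∀ j, label (p j) ≠ i := by
  by_contra! h
  obtain ⟨j₀⟩ := ‹Nonempty ι›
  have key : ∀ i k, (Fin.cons 0 (p j₀) : Fin (n + 2) → ℝ) k ≤
      (Fin.cons 0 (p j₀) : Fin (n + 2) → ℝ) i + 1 / 2 := by
    intro i k
    obtain ⟨j, rfl⟩ := h i
    have h1 := abs_le.1 ((abs_cons_sub_le (p j₀) (p j) k).trans (hd _ _))
    have h2 := abs_le.1 ((abs_cons_sub_le (p j₀) (p j) (label (p j))).trans (hd _ _))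
    linarith [le_label (p j) k, h1.2, h2.1]
  have : ‖p j₀‖ ≤ 1 / 2 := by
    refine (pi_norm_le_iff_of_nonneg (by norm_num)).2 fun k => ?_
    have h1 := key 0 k.succ
    have h2 := key k.succ 0
    simp only [Fin.cons_zero, Fin.cons_succ] at h1 h2
    rw [Real.norm_eq_abs, abs_le]
    constructor <;> linarith
  rw [hp] at this
  norm_num at this

/-- The affine map from the simplex onto a simplex around the origin. -/
def diff (y : Fin (n + 2) → ℝ) : Fin (n + 1) → ℝ := fun k => y k.succ - y 0

theorem continuous_diff : Continuous (diff (n := n)) := by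
  unfold diff
  fun_prop

/-- A map from the simplex to the cube, carrying the boundary to the boundary. -/
noncomputable def toCube (y : Fin (n + 2) → ℝ) : Fin (n + 1) → ℝ :=
  (‖diff y‖ + ∏ i, y i)⁻¹ • diff y

/-- On the simplex `diff` vanishes only at the barycenter, where the product is positive. The
product vanishes on the boundary, which is why `toCube` has norm 1 there. -/
theorem denominator_pos {y : Fin (n + 2) → ℝ} (hy : y ∈ stdSimplex ℝ (Fin (n + 2))) :
    0 < ‖diff y‖ + ∏ i, y i := by
  have h0 : 0 ≤ ∏ i, y i := Finset.prod_nonneg fun i _ => hy.1 i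
  by_cases h : diff y = 0
  · have heq : ∀ i, y i = y 0 := by
      intro i
      refine Fin.cases rfl (fun k => ?_) i
      exact sub_eq_zero.1 (congrFun h k)
    have hsum := hy.2
    have hpos : 0 < y 0 := by
      refine lt_of_le_of_ne (hy.1 0) fun h0 => ?_
      simp [heq, ← h0] at hsum
    have : 0 < ∏ i, y i := Finset.prod_pos fun i _ => by rw [heq]; exact hpos
    positivity
  · have := norm_pos_iff.2 h
    positivity

theorem norm_toCube_le {y : Fin (n + 2) → ℝ} (hy : y ∈ stdSimplex ℝ (Fin (n + 2))) :
    ‖toCube y‖ ≤ 1 := by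
  have h := denominator_pos hy
  rw [toCube, norm_smul, norm_inv, Real.norm_of_nonneg h.le, inv_mul_le_one₀ h]
  exact le_add_of_nonneg_right (Finset.prod_nonneg fun i _ => hy.1 i)

theorem norm_toCube_eq {y : Fin (n + 2) → ℝ} (hy : y ∈ stdSimplex ℝ (Fin (n + 2)))
    {i : Fin (n + 2)} (hi : y i = 0) : ‖toCube y‖ = 1 := by
  have h := denominator_pos hy
  have h0 : ∏ i, y i = 0 := Finset.prod_eq_zero (Finset.mem_univ i) hi
  rw [toCube, norm_smul, norm_inv, Real.norm_of_nonneg h.le]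
  rw [h0, add_zero] at h ⊢
  exact inv_mul_cancel₀ h.ne'

/-- Up to a positive factor, `(0, toCube y)` is `y` shifted by the constant `y 0`, so both have the
same largest entries. This yields the Sperner condition. -/
theorem le_of_label_toCube {y : Fin (n + 2) → ℝ} (hy : y ∈ stdSimplex ℝ (Fin (n + 2)))
    (j : Fin (n + 2)) : y j ≤ y (label (toCube y)) := by
  have h := inv_pos.2 (denominator_pos hy)
  have hcons : ∀ i, (Fin.cons 0 (toCube y) : Fin (n + 2) → ℝ) i =
      (‖diff y‖ + ∏ i, y i)⁻¹ * (y i - y 0) := by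
    intro i
    refine Fin.cases ?_ (fun i => ?_) i
    · simp
    · simp [toCube, diff]
  have := le_label (toCube y) j
  rw [hcons, hcons] at this
  linarith [le_of_mul_le_mul_left this h]

theorem label_toCube_ne {y : Fin (n + 2) → ℝ} (hy : y ∈ stdSimplex ℝ (Fin (n + 2)))
    {i : Fin (n + 2)} (hi : y i = 0) : label (toCube y) ≠ i := by
  rintro rfl
  have : ∑ j, y j ≤ 0 := Finset.sum_nonpos fun j _ => (le_of_label_toCube hy j).trans hi.le
  rw [hy.2] at this
  norm_num at this

theorem label_toCube_vertices (j : Fin (n + 2)) : label (toCube (vertices (n + 2) j)) = j := by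
  by_contra h
  have hle := le_of_label_toCube (vertices_mem (n + 2) j) j
  have hne : vertices (n + 2) j (label (toCube (vertices (n + 2) j))) = 0 := Pi.single_eq_of_ne h _
  rw [hne, vertices, Pi.single_eq_same] at hle
  norm_num at hle

theorem labelCochain_toCube (k : ℕ) : labelCochain (fun y => label (toCube y))
    ((sd (n + 1))^[k] (bd (n + 1) (of (vertices (n + 2))))) = 1 := by
  refine labelCochain_sd_iterate_bd (fun y => label (toCube y)) _ label_toCube_vertices (fun i y hy => ?_) k
  have hA : Convex ℝ (stdSimplex ℝ (Fin (n + 2)) ∩ {y | y i = 0}) :=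
    (convex_stdSimplex ℝ _).inter
      (convex_hyperplane (f := fun y : Fin (n + 2) → ℝ => y i) ⟨fun _ _ => rfl, fun _ _ => rfl⟩ 0)
  have hmem : y ∈ stdSimplex ℝ (Fin (n + 2)) ∩ {y | y i = 0} := by
    refine convexHull_min ?_ hA hy
    rintro _ ⟨j, rfl⟩
    refine ⟨vertices_mem _ _, ?_⟩
    exact Pi.single_eq_of_ne (Fin.succAbove_ne i j).symm _
  exact label_toCube_ne hmem.1 hmem.2

/-- The boundary of the cube `[-1, 1]ⁿ⁺¹`. -/
abbrev bdry (n : ℕ) : Set (Fin (n + 1) → ℝ) := Metric.sphere 0 1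

/-- The cube `[-1, 1]ⁿ⁺¹`. -/
abbrev cube (n : ℕ) : Set (Fin (n + 1) → ℝ) := Metric.closedBall 0 1

theorem bdry_subset_cube : bdry n ⊆ cube n := Metric.sphere_subset_closedBall

open Classical in
/-- The labelling of the standard simplex obtained from a map to the boundary of the cube. -/
noncomputable def simplexLabel {m : ℕ} (σ : C(stdSimplex ℝ (Fin m), bdry n)) (y : Fin m → ℝ) :
    Fin (n + 2) := if h : y ∈ stdSimplex ℝ (Fin m) then label (σ ⟨y, h⟩).1 else 0

theorem simplexLabel_of_mem {m : ℕ} (σ : C(stdSimplex ℝ (Fin m), bdry n)) {y : Fin m → ℝ}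
    (h : y ∈ stdSimplex ℝ (Fin m)) : simplexLabel σ y = label (σ ⟨y, h⟩).1 := dif_pos h

/-- The degree of a singular chain, computed on its `k`-th barycentric subdivision. -/
noncomputable def degree (k : ℕ) :
    (SingularChain.complex (TopCat.of (bdry n))).X n ⟶ AddCommGrpCat.of ℤ :=
  SingularChain.desc fun σ =>
    labelCochain (simplexLabel σ) ((sd (n + 1))^[k] (of (vertices (n + 1))))

theorem degree_sum (k : ℕ) (s : Fin (n + 2) → C(stdSimplex ℝ (Fin (n + 1)), TopCat.of (bdry n))) :
    degree k (∑ i : Fin (n + 2), (-1 : ℤ) ^ (i : ℕ) • SingularChain.of (s i)) =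
      ∑ i : Fin (n + 2), (-1 : ℤ) ^ (i : ℕ) •
        labelCochain (simplexLabel (s i)) ((sd (n + 1))^[k] (of (vertices (n + 1)))) := by
  refine (map_sum (degree k).hom _ _).trans (Finset.sum_congr rfl fun i _ => ?_)
  refine (map_zsmul (degree k).hom _ _).trans ?_
  congr 1
  exact SingularChain.desc_of _ _

/-- By uniform continuity, `σ` maps fine pieces to sets of diameter at most 1/4, which miss a label.
How fine depends on `σ`, so `degree k` is a cocycle only in this eventual sense. -/
theorem eventually_degree_d_of (σ : C(stdSimplex ℝ (Fin (n + 2)), TopCat.of (bdry n))) :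
    ∀ᶠ k in Filter.atTop,
      degree k ((SingularChain.complex (TopCat.of (bdry n))).d (n + 1) n (SingularChain.of σ)) =
        0 := by
  have huc : UniformContinuous (fun y => (σ y : bdry n)) :=
    CompactSpace.uniformContinuous_of_continuous σ.continuous
  obtain ⟨δ, hδ, hσ⟩ := Metric.uniformContinuous_iff.1 huc (1 / 4) (by norm_num)
  obtain ⟨d, hd⟩ := sd_iterate_vertices_mem (n + 2)
  have hlim : Filter.Tendsto
      (fun k : ℕ => ((n + 2 : ℕ) / ((n + 2 : ℕ) + 1) : ℝ) ^ k * d) Filter.atTop (nhds 0) := by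
    have h := tendsto_pow_atTop_nhds_zero_of_lt_one
      (r := ((n + 2 : ℕ) / ((n + 2 : ℕ) + 1) : ℝ)) (by positivity)
      ((div_lt_one (by positivity)).2 (lt_add_one _))
    simpa using h.mul_const d
  filter_upwards [hlim.eventually (gt_mem_nhds hδ)] with k hk
  rw [SingularChain.d_of, degree_sum, sum_labelCochain_face (L := simplexLabel σ), ← bd_sd_iterate]
  · refine apply_eq_zero_of_supported (labelCochain _ ∘ₗ bd (n + 1)) ?_ (hd k)
    rintro w ⟨hw, hw'⟩
    refine labelCochain_bd_of_eq_zero _ _ ?_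
    obtain ⟨i, hi⟩ := exists_label_ne (p := fun j => (σ ⟨w j, hw j⟩ : bdry n).1)
      (fun j => mem_sphere_zero_iff_norm.1 (σ ⟨w j, hw j⟩ : bdry n).2)
      (fun i j => (hσ (lt_of_le_of_lt (hw' i j) hk)).le)
    exact ⟨i, fun j => by rw [simplexLabel_of_mem σ (hw j)]; exact hi j⟩
  · intro i y hy
    rw [simplexLabel_of_mem _ hy]
    exact (simplexLabel_of_mem σ (stdSimplex.map i.succAbove ⟨y, hy⟩).2).symm

theorem eventually_degree_d (c : (SingularChain.complex (TopCat.of (bdry n))).X (n + 1)) :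
    ∀ᶠ k in Filter.atTop,
      degree k ((SingularChain.complex (TopCat.of (bdry n))).d (n + 1) n c) = 0 := by
  induction c using SingularChain.induction_on with
  | of σ => exact eventually_degree_d_of σ
  | zero => exact Filter.Eventually.of_forall fun k => by rw [map_zero, map_zero]
  | add a b ha hb =>
    filter_upwards [ha, hb] with k hka hkb
    rw [map_add, map_add, hka, hkb, add_zero]
  | neg a ha =>
    filter_upwards [ha] with k hk
    rw [map_neg, map_neg, hk, neg_zero]

/-- The singular simplex of the cube given by `toCube`. -/
noncomputable def toCubeMap : C(stdSimplex ℝ (Fin (n + 2)), TopCat.of (cube n)) where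
  toFun y := ⟨toCube y.1, by simpa using norm_toCube_le y.2⟩
  continuous_toFun := by
    refine Continuous.subtype_mk ?_ _
    refine Continuous.smul (Continuous.inv₀ ?_ fun y => (denominator_pos y.2).ne') ?_
    · have := (continuous_diff (n := n)).comp
        (continuous_subtype_val (p := fun y => y ∈ stdSimplex ℝ (Fin (n + 2))))
      refine this.norm.add ?_
      fun_prop
    · exact continuous_diff.comp continuous_subtype_val

theorem map_succAbove_apply_self (i : Fin (n + 2)) (y : stdSimplex ℝ (Fin (n + 1))) :
    (stdSimplex.map i.succAbove y).1 i = 0 := by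
  change FunOnFinite.linearMap ℝ ℝ i.succAbove y i = 0
  rw [FunOnFinite.linearMap_apply_apply]
  refine Finset.sum_eq_zero fun j hj => ?_
  exact absurd (Finset.mem_filter.1 hj).2 (Fin.succAbove_ne i j)

/-- The faces of `toCubeMap`, as singular simplices of the boundary. -/
noncomputable def faceMap (i : Fin (n + 2)) :
    C(stdSimplex ℝ (Fin (n + 1)), TopCat.of (bdry n)) where
  toFun y := ⟨toCube (stdSimplex.map i.succAbove y).1, mem_sphere_zero_iff_norm.2
    (norm_toCube_eq (stdSimplex.map i.succAbove y).2 (map_succAbove_apply_self i y))⟩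
  continuous_toFun := Continuous.subtype_mk (continuous_subtype_val.comp
    ((toCubeMap (n := n)).continuous.comp (stdSimplex.continuous_map _))) _

/-- A nonzero homology class of the boundary of the cube that vanishes in the cube. -/
theorem exists_homology_class (n : ℕ) : ∃ a : (singularHomologyZ n).obj (TopCat.of (bdry n)),
    a ≠ 0 ∧ (singularHomologyZ n).map (subspaceIncl bdry_subset_cube) a = 0 := by
  set z : (SingularChain.complex (TopCat.of (bdry n))).X n :=
    ∑ i : Fin (n + 2), (-1 : ℤ) ^ (i : ℕ) • SingularChain.of (faceMap i) with hz
  set ι := SingularChain.complexMap (subspaceIncl (bdry_subset_cube (n := n)))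
  have hι : ∀ m, Function.Injective (ι.f m) := SingularChain.complexMap_f_injective _
    (Set.inclusion_injective bdry_subset_cube)
  have hzd : ι.f n z =
      (SingularChain.complex (TopCat.of (cube n))).d (n + 1) n (SingularChain.of toCubeMap) := by
    rw [SingularChain.d_of]
    refine (map_sum (ι.f n).hom _ _).trans (Finset.sum_congr rfl fun i _ => ?_)
    refine (map_zsmul (ι.f n).hom _ _).trans ?_
    congr 1
    exact SingularChain.complexMap_of _ _
  obtain ⟨x, hx⟩ := ChainComplex.exists_iCycles_eq (SingularChain.complex (TopCat.of (bdry n))) n z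
    -- That `z` is a cycle is checked in the cube, where it is a boundary.
    (fun j => hι j (by
      rw [← ChainComplex.d_f_apply, hzd, map_zero, ← ConcreteCategory.comp_apply,
        HomologicalComplex.d_comp_d]
      rfl))
  refine ⟨(SingularChain.complex (TopCat.of (bdry n))).homologyπ n x, fun h0 => ?_, ?_⟩
  · obtain ⟨c, hc⟩ := (ChainComplex.homologyπ_eq_zero_iff _ n x).1 h0
    -- For large `k` the degree kills the boundary of `c`, yet it is 1 on `z` for every `k`.
    obtain ⟨k, hk⟩ := (eventually_degree_d c).exists
    rw [hc, hx, hz, degree_sum, sum_labelCochain_face (L := fun y => label (toCube y)),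
      labelCochain_toCube] at hk
    · exact one_ne_zero hk
    · intro i y hy
      rw [simplexLabel_of_mem _ hy]
      rfl
  · rw [SingularChain.singularHomologyZ_map]
    erw [ChainComplex.homologyMap_homologyπ, ChainComplex.homologyπ_eq_zero_iff]
    exact ⟨SingularChain.of toCubeMap, by rw [ChainComplex.iCycles_cyclesMap, hx, hzd]⟩

end CubeBoundary

/-! ### Embedded cubes and hereditary equivalences -/

namespace CubeBoundary

variable {n : ℕ}

theorem sub_smul_ne_zero {x p : Fin (n + 1) → ℝ} (hx : ‖x‖ = 1) (hp : ‖p‖ < 1) {t : ℝ}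
    (ht : t ∈ unitInterval) : x - t • p ≠ 0 := by
  intro h
  have : ‖x‖ ≤ ‖p‖ := by
    rw [sub_eq_zero.1 h, norm_smul, Real.norm_of_nonneg ht.1]
    exact mul_le_of_le_one_left (norm_nonneg _) ht.2
  linarith

theorem normalize_mem {x : Fin (n + 1) → ℝ} (hx : x ≠ 0) : ‖x‖⁻¹ • x ∈ bdry n := by
  rw [mem_sphere_zero_iff_norm, norm_smul, norm_inv, norm_norm]
  exact inv_mul_cancel₀ (norm_ne_zero_iff.2 hx)

theorem continuous_normalize {Z : Type*} [TopologicalSpace Z] {g : Z → Fin (n + 1) → ℝ}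
    (hg : Continuous g) (h0 : ∀ z, g z ≠ 0) : Continuous fun z => ‖g z‖⁻¹ • g z :=
  (hg.norm.inv₀ fun z => norm_ne_zero_iff.2 (h0 z)).smul hg

/-- Radial projection of the boundary of the cube from an interior point `p`. -/
noncomputable def project (p : Fin (n + 1) → ℝ) (hp : ‖p‖ < 1) : C(bdry n, bdry n) where
  toFun x := ⟨‖x.1 - p‖⁻¹ • (x.1 - p), normalize_mem (by
    simpa using sub_smul_ne_zero (mem_sphere_zero_iff_norm.1 x.2) hp unitInterval.one_mem)⟩
  continuous_toFun := by
    refine (continuous_normalize (by fun_prop) fun x => ?_).subtype_mk _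
    simpa using sub_smul_ne_zero (mem_sphere_zero_iff_norm.1 x.2) hp unitInterval.one_mem

/-- Radial projection from an interior point is homotopic to the identity. -/
noncomputable def projectHomotopy (p : Fin (n + 1) → ℝ) (hp : ‖p‖ < 1) :
    (ContinuousMap.id (bdry n)).Homotopy (project p hp) where
  toFun y := ⟨‖y.2.1 - (y.1 : ℝ) • p‖⁻¹ • (y.2.1 - (y.1 : ℝ) • p),
    normalize_mem (sub_smul_ne_zero (mem_sphere_zero_iff_norm.1 y.2.2) hp y.1.2)⟩
  continuous_toFun := by
    refine (continuous_normalize (by fun_prop) fun y => ?_).subtype_mk _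
    exact sub_smul_ne_zero (mem_sphere_zero_iff_norm.1 y.2.2) hp y.1.2
  map_zero_left x := by
    have hx := mem_sphere_zero_iff_norm.1 x.2
    ext1
    simp [hx]
  map_one_left x := by
    ext1
    simp [project]

variable {Y : Type} [TopologicalSpace Y]

/-- The image of the boundary of the cube. -/
abbrev bdryImage (G : C(cube n, Y)) : Set Y := G '' {x | x.1 ∈ bdry n}

/-- The parametrization of the image of the boundary. -/
noncomputable def toBdryImage (G : C(cube n, Y)) : TopCat.of (bdry n) ⟶ TopCat.of (bdryImage G) :=
  TopCat.ofHom ⟨fun x => ⟨G ⟨x.1, bdry_subset_cube x.2⟩, _, x.2, rfl⟩, by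
    refine Continuous.subtype_mk (G.continuous.comp ?_) _
    fun_prop⟩

theorem map_toBdryImage_eq_zero (G : C(cube n, Y))
    {a : (singularHomologyZ n).obj (TopCat.of (bdry n))}
    (ha : (singularHomologyZ n).map (subspaceIncl bdry_subset_cube) a = 0)
    (h : bdryImage G ⊆ Set.range G) : (singularHomologyZ n).map (subspaceIncl h)
      ((singularHomologyZ n).map (toBdryImage G) a) = 0 := by
  have hfac : toBdryImage G ≫ subspaceIncl h = subspaceIncl bdry_subset_cube ≫
      TopCat.ofHom ⟨Set.rangeFactorization G, G.continuous.subtype_mk _⟩ := rfl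
  rw [← ConcreteCategory.comp_apply, ← Functor.map_comp, hfac, Functor.map_comp,
    ConcreteCategory.comp_apply, ha, map_zero]

/-- If `N` missed `G p`, projecting from `p` would map `N` to the boundary of the cube. On that
boundary the projection is homotopic to the identity, so `a` would vanish. -/
theorem mem_of_map_toBdryImage_eq_zero [T2Space Y] (G : C(cube n, Y)) (hG : Function.Injective G)
    {a : (singularHomologyZ n).obj (TopCat.of (bdry n))} (ha : a ≠ 0) {N : Set Y}
    (hN : N ⊆ Set.range G) (h : bdryImage G ⊆ N)
    (haN : (singularHomologyZ n).map (subspaceIncl h)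
      ((singularHomologyZ n).map (toBdryImage G) a) = 0)
    (p : cube n) (hp : ‖p.1‖ < 1) : G p ∈ N := by
  by_contra hpN
  have hemb : Topology.IsEmbedding G := (G.continuous.isClosedEmbedding hG).isEmbedding
  let g : C(N, Fin (n + 1) → ℝ) :=
    ⟨fun q => (hemb.toHomeomorph.symm ⟨q.1, hN q.2⟩).1, by fun_prop⟩
  have hgG : ∀ x : cube n, ∀ hx : G x ∈ N, g ⟨G x, hx⟩ = x.1 := fun x hx =>
    congrArg Subtype.val (hemb.toHomeomorph.symm_apply_apply x)
  have hg : ∀ q : N, g q - p.1 ≠ 0 := by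
    rintro ⟨q, hq⟩ h0
    obtain ⟨x, rfl⟩ := hN hq
    rw [hgG, sub_eq_zero] at h0
    rw [Subtype.ext h0] at hq
    exact hpN hq
  let r : TopCat.of N ⟶ TopCat.of (bdry n) := TopCat.ofHom
    ⟨fun q => ⟨‖g q - p.1‖⁻¹ • (g q - p.1), normalize_mem (hg q)⟩,
      (continuous_normalize (by fun_prop) hg).subtype_mk _⟩
  have hr : toBdryImage G ≫ subspaceIncl h ≫ r = TopCat.ofHom (project p.1 hp) := by
    ext x : 2
    exact congrArg (fun v => ‖v - p.1‖⁻¹ • (v - p.1))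
      (hgG ⟨x.1, bdry_subset_cube x.2⟩ (h ⟨_, x.2, rfl⟩))
  have hid : (singularHomologyZ n).map (TopCat.ofHom (project p.1 hp)) = 𝟙 _ := by
    rw [← (singularHomologyZ n).map_id]
    exact (TopCat.Homotopy.congr_homologyMap_singularChainComplexFunctor
      (f := 𝟙 (TopCat.of (bdry n))) (g := TopCat.ofHom (project p.1 hp))
      (projectHomotopy p.1 hp) (AddCommGrpCat.of ℤ) n).symm
  refine ha ?_
  calc a = (singularHomologyZ n).map (toBdryImage G ≫ subspaceIncl h ≫ r) a := by
        rw [hr, hid]; rfl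
    _ = 0 := by
        rw [Functor.map_comp, Functor.map_comp, ConcreteCategory.comp_apply,
          ConcreteCategory.comp_apply, haN, map_zero]

end CubeBoundary

open CubeBoundary in
/-- A hereditary equivalence carries the interior of an embedded cube into a compact subset of
the image of the cube. -/
theorem IsHereditaryEquivalence.exists_isCompact {X Y : Type} [TopologicalSpace X] [T2Space X]
    [TopologicalSpace Y] {n : ℕ} {f : X → Y}
    (hf : IsHereditaryEquivalence (singularHomologyZ n) f) (G : C(cube n, X))
    (hG : Function.Injective G) : ∃ K : Set Y, IsCompact K ∧ K ⊆ f '' Set.range G ∧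
      ∀ p : cube n, ‖p.1‖ < 1 → f (G p) ∈ K := by
  obtain ⟨φ, hφ⟩ := hf.exists_iso
  have hφ' : ∀ (N M : Set X) (h : N ⊆ M) (b : (singularHomologyZ n).obj (TopCat.of N)),
      (φ M).hom ((singularHomologyZ n).map (subspaceIncl h) b) =
        (singularHomologyZ n).map (subspaceIncl (Set.image_mono h : f '' N ⊆ f '' M))
          ((φ N).hom b) := by
    intro N M h b
    rw [← ConcreteCategory.comp_apply, hφ, ConcreteCategory.comp_apply]
  obtain ⟨a, ha0, ha⟩ := exists_homology_class n
  have hBM : bdryImage G ⊆ Set.range G := Set.image_subset_range _ _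
  set b := (singularHomologyZ n).map (toBdryImage G) a with hb
  have hbM : (singularHomologyZ n).map (subspaceIncl hBM) b = 0 := map_toBdryImage_eq_zero G ha hBM
  have hfBM : f '' bdryImage G ⊆ f '' Set.range G := Set.image_mono hBM
  obtain ⟨K, hKM, hK, hbK⟩ := SingularChain.exists_isCompact_map_eq_zero hfBM ((φ _).hom b)
    (by rw [← hφ' _ _ hBM, hbM, map_zero])
  refine ⟨K, hK, hKM, fun p hp => ?_⟩
  -- Every such `L` is the image of some `N`, and the isomorphism for `N` brings the vanishing back
  -- to the domain.
  have key : ∀ (L : Set Y) (hL : f '' bdryImage G ⊆ L), L ⊆ f '' Set.range G →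
      (singularHomologyZ n).map (subspaceIncl hL) ((φ _).hom b) = 0 → f (G p) ∈ L := by
    intro L hL hLM hbL
    obtain ⟨N, hNM, rfl⟩ := Set.subset_image_iff.1 hLM
    have hBN : bdryImage G ⊆ N := (Set.image_subset_image_iff hf.bijective.1).1 hL
    have h0 : (singularHomologyZ n).map (subspaceIncl hBN) b = 0 := by
      rw [← hφ' _ _ hBN] at hbL
      have := congrArg (φ N).inv hbL
      rwa [map_zero, ← ConcreteCategory.comp_apply, Iso.hom_inv_id] at this
    exact ⟨_, mem_of_map_toBdryImage_eq_zero G hG ha0 hNM hBN h0 p hp, rfl⟩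
  refine (key _ _ (Set.union_subset hfBM hKM) hbK).resolve_left ?_
  rintro ⟨_, ⟨x, hx, rfl⟩, hxp⟩
  rw [hG (hf.bijective.1 hxp)] at hx
  exact hp.ne (mem_sphere_zero_iff_norm.1 hx)

/-! ### Cubes in the Hilbert cube through a convergent sequence -/

namespace HilbertCube

open Filter Topology CubeBoundary

/-- A section of the first coordinate through the points of a convergent sequence. -/
theorem exists_section {u : ℕ → HilbertCube} {x : HilbertCube} (hu : Tendsto u atTop (𝓝 x))
    (hinj : Function.Injective fun k => u k 0) (hne : ∀ k, u k 0 ≠ x 0) :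
    ∃ h : C(unitInterval, HilbertCube), (∀ t, h t 0 = t) ∧ (∀ k, h (u k 0) = u k) ∧
      h (x 0) = x := by
  -- The sequence with its limit is a compact set, embedded in the interval by its first coordinate.
  -- Tietze extends the inverse, and resetting coordinate 0 to `t` makes the extension a section.
  let F : C(OnePoint ℕ, HilbertCube) := OnePoint.continuousMapMkNat u x hu
  let e : C(OnePoint ℕ, unitInterval) := ⟨fun y => F y 0, by fun_prop⟩
  have he : Function.Injective e := by
    intro a b hab
    induction a using OnePoint.rec with
    | infty =>
      induction b using OnePoint.rec with
      | infty => rfl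
      | coe k => exact absurd hab.symm (hne k)
    | coe m =>
      induction b using OnePoint.rec with
      | infty => exact absurd hab (hne m)
      | coe k => exact congrArg _ (hinj hab)
  obtain ⟨g, hg⟩ := ContinuousMap.exists_extension' (e.continuous.isClosedEmbedding he) F
  have hg' : ∀ y, Function.update (g (e y)) 0 (e y) = F y := by
    intro y
    rw [show g (e y) = F y from congrFun hg y]
    exact Function.update_eq_self (β := fun _ => unitInterval) 0 (F y)
  refine ⟨⟨fun t => Function.update (g t) 0 t, g.continuous.update 0 continuous_id⟩, ?_, ?_, ?_⟩
  · intro t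
    exact Function.update_self (β := fun _ => unitInterval) 0 t (g t)
  · intro k
    exact hg' (k : OnePoint ℕ)
  · exact hg' OnePoint.infty

variable {n : ℕ}

/-- The nonnegative coordinates recording the positive and negative parts of all coordinates
but the first. -/
noncomputable def part (j : ℕ) (s : Fin (n + 1) → ℝ) : ℝ :=
  if h : j / 2 ≠ 0 ∧ j / 2 < n + 1 then max 0 ((-1) ^ j * s ⟨j / 2, h.2⟩) else 0

theorem continuous_part (j : ℕ) : Continuous (part (n := n) j) := by
  unfold part
  split_ifs <;> fun_prop

theorem part_nonneg (j : ℕ) (s : Fin (n + 1) → ℝ) : 0 ≤ part j s := by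
  unfold part
  split_ifs
  · exact le_max_left _ _
  · exact le_rfl

theorem part_le_one (j : ℕ) {s : Fin (n + 1) → ℝ} (hs : ‖s‖ ≤ 1) : part j s ≤ 1 := by
  unfold part
  split_ifs with h
  · refine max_le zero_le_one ((le_abs_self _).trans ?_)
    rw [abs_mul, abs_pow, abs_neg, abs_one, one_pow, one_mul]
    exact (norm_le_pi_norm s _).trans hs
  · exact zero_le_one

theorem part_zero (s : Fin (n + 1) → ℝ) : part 0 s = 0 := by simp [part]

theorem part_single (j : ℕ) (c : ℝ) : part j (Pi.single 0 c : Fin (n + 1) → ℝ) = 0 := by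
  unfold part
  split_ifs with h
  · rw [Pi.single_eq_of_ne (fun h' => h.1 (congrArg Fin.val h')), mul_zero, max_self]
  · rfl

theorem ext_of_part {s s' : Fin (n + 1) → ℝ} (h0 : s 0 = s' 0)
    (h : ∀ j < 2 * n + 2, part j s = part j s') : s = s' := by
  funext i
  by_cases hi : i = 0
  · rw [hi, h0]
  · have hi0 : i.1 ≠ 0 := fun h => hi (Fin.ext h)
    have hdiv1 : 2 * i.1 / 2 = i.1 := by omega
    have hdiv2 : (2 * i.1 + 1) / 2 = i.1 := by omega
    have h1 := h (2 * i.1) (by omega)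
    have h2 := h (2 * i.1 + 1) (by omega)
    simp only [part, hdiv1, hdiv2, ne_eq, hi0, not_false_eq_true, i.2, and_self, dite_true,
      pow_mul, pow_succ, pow_zero, one_mul, neg_mul, neg_neg, mul_neg, one_pow] at h1 h2
    rcases max_cases 0 (s i) with ⟨_, _⟩ | ⟨_, _⟩ <;> rcases max_cases 0 (s' i) with ⟨_, _⟩ | ⟨_, _⟩ <;>
      rcases max_cases 0 (-s i) with ⟨_, _⟩ | ⟨_, _⟩ <;>
      rcases max_cases 0 (-s' i) with ⟨_, _⟩ | ⟨_, _⟩ <;> linarith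

/-- A short arc of the section is thickened in finitely many coordinates. Each is moved only toward
an endpoint of the interval, so a signed parameter needs two of them, for its positive and negative
parts; coordinate 0 stays free to record `t`. The neighbourhood is punctured because `x` itself lies
on the boundary of the cube when `x 0` is 0 or 1. -/
theorem exists_cube_of_section {x z : HilbertCube} (hz : z ≠ x)
    (h : C(unitInterval, HilbertCube)) (h0 : ∀ t, h t 0 = t) (hx : h (x 0) = x) (n : ℕ) :
    ∃ G : C(cube n, HilbertCube), Function.Injective G ∧ z ∉ Set.range G ∧
      ∀ᶠ t in 𝓝[≠] (x 0), ∃ p : cube n, ‖p.1‖ < 1 ∧ G p = h t := by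
  obtain ⟨j, hj⟩ := Function.ne_iff.1 hz
  set η : ℝ := |(z j : ℝ) - x j| with hη
  have hηpos : 0 < η := abs_pos.2 (sub_ne_zero.2 fun h => hj (Subtype.ext h))
  have hclose : ∀ (i : ℕ) (δ : ℝ), 0 < δ → ∀ᶠ t in 𝓝 (x 0), |(h t i : ℝ) - x i| < δ := by
    intro i δ hδ
    have hc : Continuous fun t => |(h t i : ℝ) - x i| := by fun_prop
    refine hc.continuousAt.eventually_lt continuousAt_const ?_
    rw [hx, sub_self, abs_zero]
    exact hδ
  have hev : ∀ᶠ t in 𝓝 (x 0), |(h t j : ℝ) - x j| < η / 2 ∧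
      ∀ i ∈ Finset.range (2 * n + 2), |(h t i : ℝ) - x i| < 1 / 2 :=
    (hclose j _ (by positivity)).and
      ((Finset.eventually_all _).2 fun i _ => hclose i _ (by norm_num))
  obtain ⟨ρ', hρ', hball⟩ := Metric.eventually_nhds_iff.1 hev
  set ρ := ρ' / 2 with hρ
  have hρpos : 0 < ρ := by positivity
  set a : ℝ := max 0 (x 0 - ρ) with ha
  set b : ℝ := min 1 (x 0 + ρ) with hb
  have hx0 := (x 0).2.1
  have hx1 := (x 0).2.2
  have hab : a < b := by
    rw [ha, hb, max_lt_iff, lt_min_iff, lt_min_iff]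
    refine ⟨⟨?_, ?_⟩, ?_, ?_⟩ <;> linarith
  have ha0 : 0 ≤ a := le_max_left _ _
  have hb1 : b ≤ 1 := min_le_left _ _
  have hax : (x 0 : ℝ) - ρ ≤ a := le_max_right _ _
  have hbx : b ≤ x 0 + ρ := min_le_right _ _
  have hs0 : ∀ s : cube n, -1 ≤ s.1 0 ∧ s.1 0 ≤ 1 := fun s =>
    abs_le.1 ((norm_le_pi_norm s.1 0).trans (mem_closedBall_zero_iff.1 s.2))
  have hτmem : ∀ s : cube n, a ≤ a + (s.1 0 + 1) / 2 * (b - a) ∧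
      a + (s.1 0 + 1) / 2 * (b - a) ≤ b := by
    intro s
    obtain ⟨h1, h2⟩ := hs0 s
    constructor <;> nlinarith
  have hs0c : Continuous fun s : cube n => s.1 0 :=
    (continuous_apply 0).comp continuous_subtype_val
  let τ : C(cube n, unitInterval) := ⟨fun s => ⟨a + (s.1 0 + 1) / 2 * (b - a),
    ha0.trans (hτmem s).1, (hτmem s).2.trans hb1⟩,
    (continuous_const.add (((hs0c.add continuous_const).div_const 2).mul
      continuous_const)).subtype_mk _⟩
  have hτ : ∀ s, |(h (τ s) j : ℝ) - x j| < η / 2 ∧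
      ∀ i ∈ Finset.range (2 * n + 2), |(h (τ s) i : ℝ) - x i| < 1 / 2 := by
    intro s
    refine hball ?_
    rw [Subtype.dist_eq, Real.dist_eq, abs_lt]
    have h1 := hτmem s
    change -ρ' < a + (s.1 0 + 1) / 2 * (b - a) - x 0 ∧ a + (s.1 0 + 1) / 2 * (b - a) - x 0 < ρ'
    constructor <;> linarith
  -- The endpoint at distance at least 1/2 from `x i`; the arc stays closer than that to `x i`, so
  -- motion toward `c i` is never degenerate.
  let c : ℕ → ℝ := fun i => if (x i : ℝ) < 1 / 2 then 1 else 0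
  have hc : ∀ i, 0 ≤ c i ∧ c i ≤ 1 ∧ 1 / 2 ≤ |(x i : ℝ) - c i| := by
    intro i
    have h1 := (x i).2.1
    have h2 := (x i).2.2
    by_cases hi : (x i : ℝ) < 1 / 2
    · simp only [c, hi, if_true]
      refine ⟨by norm_num, le_rfl, ?_⟩
      rw [abs_of_nonpos] <;> linarith
    · simp only [c, hi, if_false]
      refine ⟨le_rfl, by norm_num, ?_⟩
      rw [abs_of_nonneg] <;> linarith
  -- The bound 1 keeps points in the Hilbert cube; with the bound `η / 2`, arc and thickening
  -- together move coordinate `j` by less than `η`, so `z` is missed.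
  set ε : ℝ := min 1 (η / 2) with hε
  have hεpos : 0 < ε := lt_min one_pos (by positivity)
  have hw : ∀ i (s : cube n), 0 ≤ ε * part i s.1 ∧ ε * part i s.1 ≤ ε := fun i s =>
    ⟨mul_nonneg hεpos.le (part_nonneg _ _),
      mul_le_of_le_one_right hεpos.le (part_le_one _ (mem_closedBall_zero_iff.1 s.2))⟩
  have hmem : ∀ i (s : cube n),
      (h (τ s) i : ℝ) + ε * part i s.1 * (c i - h (τ s) i) ∈ unitInterval := by
    intro i s
    obtain ⟨h1, h2⟩ := hw i s
    have h3 : ε * part i s.1 ≤ 1 := h2.trans (min_le_left _ _)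
    obtain ⟨c0, c1, _⟩ := hc i
    obtain ⟨t0, t1⟩ := (h (τ s) i).2
    constructor <;> nlinarith
  let G : C(cube n, HilbertCube) := ⟨fun s i => ⟨_, hmem i s⟩, by
    refine continuous_pi fun i => Continuous.subtype_mk ?_ _
    have hp : Continuous fun s : cube n => part i s.1 :=
      (continuous_part i).comp continuous_subtype_val
    have hh : Continuous fun s : cube n => (h (τ s) i : ℝ) := by fun_prop
    exact hh.add ((continuous_const.mul hp).mul (continuous_const.sub hh))⟩
  have hG : ∀ s i, (G s i : ℝ) = h (τ s) i + ε * part i s.1 * (c i - h (τ s) i) := fun _ _ => rfl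
  refine ⟨G, ?_, ?_, ?_⟩
  · intro s s' hss
    have hττ : τ s = τ s' := by
      have := hG s 0
      rw [hss, hG, part_zero, part_zero, h0, h0] at this
      refine Subtype.ext ?_
      simpa using this.symm
    refine Subtype.ext (ext_of_part ?_ fun i hi => ?_)
    · have := congrArg Subtype.val hττ
      change a + (s.1 0 + 1) / 2 * (b - a) = a + (s'.1 0 + 1) / 2 * (b - a) at this
      have h2 := mul_right_cancel₀ (sub_ne_zero.2 hab.ne') (add_left_cancel this)
      linarith
    · have := hG s i
      rw [hss, hG, hττ] at this
      have hne : c i - h (τ s') i ≠ 0 := by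
        intro h0
        have h1 := (hτ s').2 i (Finset.mem_range.2 hi)
        rw [← sub_eq_zero.1 h0, abs_sub_comm] at h1
        exact (hc i).2.2.not_gt h1
      exact (mul_left_cancel₀ hεpos.ne' (mul_right_cancel₀ hne (add_left_cancel this))).symm
  · rintro ⟨s, hs⟩
    have h1 := (hτ s).1
    obtain ⟨h2, h3⟩ := hw j s
    obtain ⟨c0, c1, _⟩ := hc j
    obtain ⟨t0, t1⟩ := (h (τ s) j).2
    have h4 : |c j - h (τ s) j| ≤ 1 := abs_le.2 ⟨by linarith, by linarith⟩
    have h5 : |ε * part j s.1 * (c j - h (τ s) j)| ≤ η / 2 := by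
      rw [abs_mul, abs_of_nonneg h2]
      refine (mul_le_of_le_one_right h2 h4).trans (h3.trans (min_le_right _ _))
    have h6 : η ≤ |(h (τ s) j : ℝ) - x j| + |ε * part j s.1 * (c j - h (τ s) j)| := by
      rw [hη, ← hs, hG, add_sub_right_comm]
      exact abs_add_le _ _
    linarith
  · have hlt : ∀ᶠ t : unitInterval in 𝓝[≠] (x 0), a < t ∧ (t : ℝ) < b := by
      have hnear : ∀ᶠ t : unitInterval in 𝓝 (x 0), |(t : ℝ) - x 0| < ρ :=
        (hclose 0 ρ hρpos).mono fun t ht => by rwa [h0] at ht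
      have hpos : ∀ᶠ t : unitInterval in 𝓝[≠] (x 0), 0 < t := by
        by_cases hx : x 0 = 0
        · filter_upwards [self_mem_nhdsWithin] with t ht
          rw [hx] at ht
          exact unitInterval.pos_iff_ne_zero.2 ht
        · exact nhdsWithin_le_nhds (lt_mem_nhds (unitInterval.pos_iff_ne_zero.2 hx))
      have hone : ∀ᶠ t : unitInterval in 𝓝[≠] (x 0), t < 1 := by
        by_cases hx : x 0 = 1
        · filter_upwards [self_mem_nhdsWithin] with t ht
          rw [hx] at ht
          exact unitInterval.lt_one_iff_ne_one.2 ht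
        · exact nhdsWithin_le_nhds (gt_mem_nhds (unitInterval.lt_one_iff_ne_one.2 hx))
      filter_upwards [hpos, hone, nhdsWithin_le_nhds hnear] with t h1 h2 h3
      have h1' : (0 : ℝ) < t := h1
      have h2' : (t : ℝ) < 1 := h2
      obtain ⟨h4, h5⟩ := abs_lt.1 h3
      exact ⟨max_lt h1' (by linarith), lt_min h2' (by linarith)⟩
    filter_upwards [hlt] with t ⟨hta, htb⟩
    have hba : 0 < b - a := sub_pos.2 hab
    have hq1 : 0 < (t - a) / (b - a) := div_pos (by linarith) hba
    have hq2 : (t - a) / (b - a) < 1 := (div_lt_one hba).2 (by linarith)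
    have hnorm : ‖(Pi.single 0 (2 * ((t - a) / (b - a)) - 1) : Fin (n + 1) → ℝ)‖ < 1 := by
      rw [Pi.norm_single, Real.norm_eq_abs, abs_lt]
      constructor <;> linarith
    let p : cube n := ⟨Pi.single 0 (2 * ((t - a) / (b - a)) - 1),
      mem_closedBall_zero_iff.2 hnorm.le⟩
    have hτp : τ p = t := by
      refine Subtype.ext ?_
      change a + ((Pi.single 0 (2 * ((t - a) / (b - a)) - 1) : Fin (n + 1) → ℝ) 0 + 1) / 2 *
        (b - a) = t
      rw [Pi.single_eq_same]
      field_simp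
      ring
    refine ⟨p, hnorm, funext fun i => Subtype.ext ?_⟩
    rw [hG, part_single, mul_zero, zero_mul, add_zero, hτp]

/-! ### Continuity of hereditary equivalences. -/

theorem exists_subseq_injective {α : Type*} [MetricSpace α] {t : ℕ → α} {l : α}
    (ht : Tendsto t atTop (𝓝 l)) (hne : ∀ k, t k ≠ l) :
    ∃ φ : ℕ → ℕ, StrictMono φ ∧ Function.Injective (t ∘ φ) := by
  -- The reciprocal distances tend to infinity, hence increase strictly along a subsequence.
  have h0 : Tendsto (fun k => dist (t k) l) atTop (𝓝[>] 0) :=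
    tendsto_nhdsWithin_iff.2 ⟨tendsto_iff_dist_tendsto_zero.1 ht,
      Eventually.of_forall fun k => dist_pos.2 (hne k)⟩
  obtain ⟨φ, hφ, hφ'⟩ := strictMono_subseq_of_tendsto_atTop h0.inv_tendsto_nhdsGT_zero
  refine ⟨φ, hφ, fun k m hkm => hφ'.injective ?_⟩
  simp only [Function.comp_apply, Pi.inv_apply] at hkm ⊢
  rw [hkm]

theorem continuousWithinAt {n : ℕ} {f : HilbertCube → HilbertCube}
    (hf : IsHereditaryEquivalence (singularHomologyZ n) f) (x : HilbertCube) :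
    ContinuousWithinAt f {q | q 0 ≠ x 0} x := by
  by_contra hcon
  simp only [ContinuousWithinAt, tendsto_def, not_forall] at hcon
  obtain ⟨V, hV, hVf⟩ := hcon
  obtain ⟨V', hV'V, hV'o, hxV'⟩ := mem_nhds_iff.1 hV
  have hfreq : ∃ᶠ q in 𝓝[{q | q 0 ≠ x 0}] x, q 0 ≠ x 0 ∧ f q ∉ V' := by
    intro hev
    refine hVf ?_
    filter_upwards [hev, self_mem_nhdsWithin] with q hq hq0
    by_contra hqV
    exact hq ⟨hq0, fun h => hqV (hV'V h)⟩
  obtain ⟨v, hv, hv'⟩ := exists_seq_forall_of_frequently hfreq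
  replace hv := tendsto_nhds_of_tendsto_nhdsWithin hv
  obtain ⟨φ, hφ, hinj⟩ := exists_subseq_injective (t := fun k => v k 0) (l := x 0)
    ((continuous_apply 0).tendsto x |>.comp hv) fun k => (hv' k).1
  -- Compactness of the target and surjectivity of `f` supply the point `z` that the cube must
  -- avoid.
  obtain ⟨y, ψ, hψ, hy⟩ := CompactSpace.tendsto_subseq fun k => f (v (φ k))
  set u : ℕ → HilbertCube := fun k => v (φ (ψ k)) with hu
  have hux : Tendsto u atTop (𝓝 x) := hv.comp (hφ.tendsto_atTop.comp hψ.tendsto_atTop)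
  have hyV : y ∉ V' := fun hyV => by
    obtain ⟨k, hk⟩ := (hy.eventually (hV'o.mem_nhds hyV)).exists
    exact (hv' _).2 hk
  obtain ⟨z, rfl⟩ := hf.bijective.2 y
  have hzx : z ≠ x := by
    rintro rfl
    exact hyV hxV'
  obtain ⟨h, h0, hhu, hhx⟩ := exists_section hux (hinj.comp hψ.injective) fun k => (hv' _).1
  obtain ⟨G, hG, hzG, hGh⟩ := exists_cube_of_section hzx h h0 hhx n
  obtain ⟨K, hK, hKG, hfK⟩ := hf.exists_isCompact G hG
  have hu0 : Tendsto (fun k => u k 0) atTop (𝓝[≠] (x 0)) := tendsto_nhdsWithin_iff.2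
    ⟨(continuous_apply 0).tendsto x |>.comp hux, Eventually.of_forall fun k => (hv' _).1⟩
  have hzK : f z ∈ K := by
    refine hK.isClosed.mem_of_tendsto hy ?_
    filter_upwards [hu0.eventually hGh] with k ⟨p, hp, hGp⟩
    have := hfK p hp
    rwa [hGp, hhu] at this
  obtain ⟨z', hz', hzz'⟩ := hKG hzK
  rw [hf.bijective.1 hzz'] at hz'
  exact hzG hz'

theorem dense_first_coordinate_ne (t : unitInterval) : Dense {q : HilbertCube | q 0 ≠ t} :=
  (dense_compl_singleton t).preimage (isOpenMap_eval (X := fun _ : ℕ => unitInterval) 0)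

/-- At a point `q` near `x` with the same first coordinate, `f q` is a limit of values at nearby
points off that slice; these lie in a closed neighbourhood of `f x`. -/
theorem continuous_of_continuousWithinAt {Y : Type*} [TopologicalSpace Y] [RegularSpace Y]
    {f : HilbertCube → Y} (hf : ∀ x, ContinuousWithinAt f {q | q 0 ≠ x 0} x) : Continuous f := by
  refine continuous_iff_continuousAt.2 fun x V hV => ?_
  obtain ⟨C, hC, hCc, hCV⟩ := exists_mem_nhds_isClosed_subset hV
  obtain ⟨U, hUo, hxU, hU⟩ := mem_nhdsWithin.1 (hf x hC)
  refine mem_map.2 (mem_of_superset (hUo.mem_nhds hxU) fun q hq => hCV ?_)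
  by_cases hqx : q 0 = x 0
  · have : (𝓝[{q' | q' 0 ≠ q 0}] q).NeBot :=
      mem_closure_iff_nhdsWithin_neBot.1 (dense_first_coordinate_ne (q 0) q)
    refine hCc.mem_of_tendsto (hf q) ?_
    filter_upwards [nhdsWithin_le_nhds (hUo.mem_nhds hq), self_mem_nhdsWithin] with q' hq' hne
    exact hU ⟨hq', hqx ▸ hne⟩
  · exact hU ⟨hq, hqx⟩

end HilbertCube

theorem mainTheorem6 (n : ℕ) (f : HilbertCube → HilbertCube)
    (hf : IsHereditaryEquivalence (singularHomologyZ n) f) :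
    IsHomeomorph f := by
  rw [isHomeomorph_iff_continuous_bijective]
  exact ⟨HilbertCube.continuous_of_continuousWithinAt (HilbertCube.continuousWithinAt hf),
    hf.bijective⟩
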